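/- \textbf{Setting.} Let $d\ge 2$, let $\Omega\subset\mathbb R^d$ be open and bounded with $\Omega=\operatorname{int}\overline\Omega\neq\emptyset$, $\overline\Omega$ connected, and with a boundary made of finitely many flat faces ($\Omega$ need not be convex). Let $\partial\Omega$ be the disjoint union of $\partial\Omega_D,\partial\Omega_R,\partial\Omega_t$. A generalised face is the intersection of an open $(d-1)$-dimensional face of $\Omega$ with one of these three sets; $PC(\partial\Omega)$ denotes the bounded functions, defined at every point of $\partial\Omega$, that are continuous on each generalised face, with the supremum norm. Let $A$ be a non-empty compact metric space, $T>0$, and let $\alpha\mapsto(a^\alpha,b^\alpha,c^\alpha,f^\alpha)$ (with values in $C(\overline\Omega)\times C(\overline\Omega,\mathbb R^d)\times C(\overline\Omega)\times C(\overline\Omega)$) and $\alpha\mapsto(b^\alpha_{\partial\Omega},c^\alpha_{\partial\Omega},g^\alpha)$ (with values in $PC(\partial\Omega,\mathbb R^d)\times PC(\partial\Omega)\times PC(\partial\Omega)$) be continuous for the supremum norms. Let $g\in C(\partial\Omega)$, $v_T\in C(\overline\Omega)$, $v_T=g$ on $\partial\Omega_D$, and $a^\alpha,c^\alpha,c^\alpha_{\partial\Omega},g^\alpha,g,v_T\ge0$.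 For $x\in\partial\Omega$ let $b^\alpha_{\partial\Omega}(x)\in K(x):=\{b:\exists\Lambda>0\ \forall\lambda\in[0,\Lambda]:\ x+\lambda b\in\overline\Omega\}$. Put $L^\alpha(x,q,p,s)=-a^\alpha(x)q-b^\alpha(x)\cdot p+c^\alpha(x)s$, $L^\alpha_{\partial\Omega}(x,p,s)=-b^\alpha_{\partial\Omega}(x)\cdot p+c^\alpha_{\partial\Omega}(x)s$ and \[ F(t,x,q,p,r,s)=\begin{cases}-r+\sup_\alpha(L^\alpha(x,q,p,s)-f^\alpha(x)), & t\in[0,T),\ x\in\Omega,\\ -r+\sup_\alpha(L^\alpha_{\partial\Omega}(x,p,s)-g^\alpha(x)), & t\in[0,T),\ x\in\partial\Omega_t,\\ \sup_\alpha(L^\alpha_{\partial\Omega}(x,p,s)-g^\alpha(x)), & t\in[0,T),\ x\in\partial\Omega_R,\\ s-g(x), & t\in[0,T),\ x\in\partial\Omega_D,\\ s-v_T(x), & t=T,\ x\in\overline\Omega.\end{cases} \] $F^*$ and $F_*$ are the upper and lower semicontinuous envelopes of $F$ on $[0,T]\times\overline\Omega\times\mathbb R\times\mathbb R^d\times\mathbb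 R\times\mathbb R$. \textbf{Discretisation.} For $i\in\mathbb N$ let $\mathcal T_i$ be conforming simplicial meshes of $\overline\Omega$, shape-regular uniformly in $i$, with mesh size tending to $0$, such that every open $(d-1)$-dimensional mesh face in $\partial\Omega$ lies in exactly one generalised face. Let $V_i$ be the space of continuous functions on $\overline\Omega$ that are affine on each element, with nodes $y_i^\ell$, hat functions $\phi_i^\ell$ and $\hat\phi_i^\ell=\phi_i^\ell/\|\phi_i^\ell\|_{L^1(\Omega)}$. Let $h_i>0$, $T/h_i\in\mathbb N$, $h_i\to0$, and $s_i^k=kh_i$ for $0\le k\le T/h_i$. Let $\bar a_i^\alpha,\bar{\bar a}_i^\alpha,\bar c_i^\alpha,\bar{\bar c}_i^\alpha\in C(\overline\Omega)$, $0\le f_i^\alpha\in C(\overline\Omega)$, $\bar b_i^\alpha,\bar{\bar b}_i^\alpha\in C(\overline\Omega,\mathbb R^d)$, $\bar b_{i,\partial\Omega}^\alpha,\bar{\bar b}_{i,\partial\Omega}^\alpha\in PC(\partial\Omega,\mathbb R^d)$ and $\bar c_{i,\partial\Omega}^\alpha,\bar{\bar c}_{i,\partial\Omega}^\alpha,g_i^\alpha\in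 PC(\partial\Omega)$ depend, for each $i$, continuously on $\alpha$ in the supremum norms, and let all coefficients with bars be bounded uniformly in $i$ and $\alpha$. Suppose that, uniformly in $\alpha\in A$ as $i\to\infty$, \[\sup_{\ell:\,y_i^\ell\notin\partial\Omega_D}\|a^\alpha-(\bar a_i^\alpha(y_i^\ell)+\bar{\bar a}_i^\alpha(y_i^\ell))\|_{L^\infty(\operatorname{supp}\hat\phi_i^\ell)}\to0,\] and that $\bar b_i^\alpha+\bar{\bar b}_i^\alpha\to b^\alpha$, $\bar c_i^\alpha+\bar{\bar c}_i^\alpha\to c^\alpha$, $f_i^\alpha\to f^\alpha$ uniformly on $\overline\Omega$ and $\bar b_{i,\partial\Omega}^\alpha+\bar{\bar b}_{i,\partial\Omega}^\alpha\to b^\alpha_{\partial\Omega}$, $\bar c_{i,\partial\Omega}^\alpha+\bar{\bar c}_{i,\partial\Omega}^\alpha\to c^\alpha_{\partial\Omega}$, $g_i^\alpha\to g^\alpha$ uniformly on $\partial\Omega$. On $\partial\Omega_R$ let $\bar b_{i,\partial\Omega}^\alpha=0$, $\bar c_{i,\partial\Omega}^\alpha=0$ and $\bar{\bar c}_{i,\partial\Omega}^\alpha>0$.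 At nodes $y\in\partial\Omega_t\cup\partial\Omega_R$ let $\bar b_{i,\partial\Omega}^\alpha(y),\bar{\bar b}_{i,\partial\Omega}^\alpha(y)\in K(y)$, and let $\partial_{-b}w(y)=\liminf_{\lambda\downarrow0}\frac{w(y)-w(y+\lambda b)}\lambda$ be the lower Dini derivative. With $\langle\cdot,\cdot\rangle$ the $L^2(\Omega)$ inner product, define for $w\in V_i$ and a node $y=y_i^\ell$ \[ (\mathsf E_i^\alpha w)_\ell=\begin{cases}\bar a_i^\alpha(y)\langle\nabla w,\nabla\hat\phi_i^\ell\rangle+\langle-\bar b_i^\alpha\cdot\nabla w+\bar c_i^\alpha w,\hat\phi_i^\ell\rangle, & y\in\Omega,\\ \partial_{-\bar b_{i,\partial\Omega}^\alpha(y)}w(y)+\bar c_{i,\partial\Omega}^\alpha(y)w(y), & y\in\partial\Omega_t\cup\partial\Omega_R,\\ 0, & y\in\partial\Omega_D,\end{cases} \] define $(\mathsf I_i^\alpha w)_\ell$ by the same formulas with double bars for $y\notin\partial\Omega_D$ and by $w(y)$ for $y\in\partial\Omega_D$, and let $(\mathsf F_i^\alpha)_\ell$ be $\langle f_i^\alpha,\hat\phi_i^\ell\rangle$,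 $g_i^\alpha(y)$, $g(y)$ in the three cases. Let $d_iw(s_i^k,y)=(w(s_i^{k+1},y)-w(s_i^k,y))/h_i$ for $y\in\Omega\cup\partial\Omega_t$ and $0$ for $y\in\partial\Omega_R\cup\partial\Omega_D$, and \[F_iw(s_i^k,y_i^\ell)=-d_iw(s_i^k,y_i^\ell)+\sup_{\alpha\in A}\bigl(\mathsf E_i^\alpha w(s_i^{k+1},\cdot)+\mathsf I_i^\alpha w(s_i^k,\cdot)-\mathsf F_i^\alpha\bigr)_\ell .\] Finally let $P_i:C^2(\mathbb R^d)\to V_i$ be linear maps, each continuous for the norm of $W^{1,\infty}(\Omega)$, with $\langle\nabla P_iw,\nabla\hat\phi_i^\ell\rangle=\langle\nabla w,\nabla\hat\phi_i^\ell\rangle$ for all nodes $y_i^\ell\in\Omega$, and such that for some $C$ independent of $i$ and all $w\in C^\infty(\mathbb R^d)$: $\|P_iw\|_{W^{1,\infty}(\Omega)}\le C\|w\|_{W^{1,\infty}(\Omega)}$ and $\|P_iw-w\|_{W^{1,\infty}(\Omega)}\to0$. For $\psi\in C^2(\mathbb R\times\mathbb R^d)$ let $P_i\psi(s,\cdot)=P_i(\psi(s,\cdot))$.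 \textbf{Theorem.} Let $\psi\in C^2(\mathbb R\times\mathbb R^d)$, and let the time steps $s_i^{k(i)}$ and nodes $y_i^{\ell(i)}$ satisfy $s_i^{k(i)}\to t\in[0,T)$ and $y_i^{\ell(i)}\to x\in\overline\Omega$ as $i\to\infty$. Then \[\limsup_{i\to\infty}F_iP_i\psi(s_i^{k(i)},y_i^{\ell(i)})\le F^*\bigl(t,x,\Delta\psi(t,x),\nabla\psi(t,x),\partial_t\psi(t,x),\psi(t,x)\bigr)\] and \[\liminf_{i\to\infty}F_iP_i\psi(s_i^{k(i)},y_i^{\ell(i)})\ge F_*\bigl(t,x,\Delta\psi(t,x),\nabla\psi(t,x),\partial_t\psi(t,x),\psi(t,x)\bigr).\] -/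

import Mathlib

open Set Filter Topology MeasureTheory
open scoped ENNReal NNReal

noncomputable section

namespace HJB

/-- Euclidean space `ℝ^d`. -/
abbrev E (d : ℕ) := EuclideanSpace ℝ (Fin d)

/-! ### Polytopic domains, faces, piecewise continuous boundary functions -/

/-- An affine hyperplane of `ℝ^d`. -/
def IsHyperplane {d : ℕ} (H : AffineSubspace ℝ (E d)) : Prop :=
  (H : Set (E d)).Nonempty ∧ Module.finrank ℝ H.direction + 1 = d

/-- A bounded polytopic domain, possibly non-convex. `Ω` is the open domain, i.e. the interior of
the closed polytope `closure Ω`; its boundary consists of finitely many flat pieces. -/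
structure IsPolytopicDomain {d : ℕ} (Ω : Set (E d)) : Prop where
  isOpen : IsOpen Ω
  nonempty : Ω.Nonempty
  isBounded : Bornology.IsBounded Ω
  isConnected : IsConnected (closure Ω)
  interior_closure : interior (closure Ω) = Ω
  flat_boundary : ∃ 𝓗 : Set (AffineSubspace ℝ (E d)), 𝓗.Finite ∧
    (∀ H ∈ 𝓗, IsHyperplane H) ∧ frontier Ω ⊆ ⋃ H ∈ 𝓗, (H : Set (E d))

/-- The boundary points near which the boundary coincides with the hyperplane `H`. -/
def flatPart {d : ℕ} (Ω : Set (E d)) (H : AffineSubspace ℝ (E d)) : Set (E d) :=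
  {x | x ∈ frontier Ω ∧ ∀ᶠ z in 𝓝 x, (z ∈ frontier Ω ↔ z ∈ H)}

/-- The open `(d-1)`-dimensional faces of `Ω`. -/
def openFaces {d : ℕ} (Ω : Set (E d)) : Set (Set (E d)) :=
  {ω | ∃ H : AffineSubspace ℝ (E d), IsHyperplane H ∧
    ∃ x ∈ flatPart Ω H, ω = connectedComponentIn (flatPart Ω H) x}

/-- The generalised faces: intersections of an open face with one of the three regions of the
boundary. -/
def generalisedFaces {d : ℕ} (Ω ΓD ΓR Γt : Set (E d)) : Set (Set (E d)) :=
  {ω | ∃ ω' ∈ openFaces Ω, ω = ω' ∩ ΓD ∨ ω = ω' ∩ ΓR ∨ ω = ω' ∩ Γt}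

/-- Piecewise continuous functions on the boundary: bounded, and continuous on every generalised
face. They have a value at every boundary point, and their norm is the supremum norm. -/
def IsPC {d : ℕ} {V : Type*} [NormedAddCommGroup V] (Ω ΓD ΓR Γt : Set (E d)) (u : E d → V) :
    Prop :=
  (∃ C : ℝ, ∀ x ∈ frontier Ω, ‖u x‖ ≤ C) ∧
    ∀ ω ∈ generalisedFaces Ω ΓD ΓR Γt, ContinuousOn u ω

/-- `α ↦ u α` is continuous for the supremum norm on `S`. -/
def ContinuousFamily {d : ℕ} {A V : Type*} [TopologicalSpace A] [NormedAddCommGroup V]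
    (S : Set (E d)) (u : A → E d → V) : Prop :=
  ∀ α, TendstoUniformlyOn u (u α) (𝓝 α) S

/-- `sup_α sup_{x ∈ S} ‖u i α x - v α x‖ → 0` as `i → ∞`. -/
def ConvergesUniformly {d : ℕ} {A V : Type*} [NormedAddCommGroup V]
    (S : Set (E d)) (u : ℕ → A → E d → V) (v : A → E d → V) : Prop :=
  TendstoUniformlyOn (fun i (p : A × E d) => u i p.1 p.2) (fun p => v p.1 p.2) atTop
    (univ ×ˢ S)

/-- The tangent cone `K(x)` of the polytope `closure Ω` at `x`. -/
def tangentCone {d : ℕ} (Ω : Set (E d)) (x : E d) : Set (E d) :=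
  {b | ∃ Λ : ℝ, 0 < Λ ∧ ∀ r ∈ Icc (0 : ℝ) Λ, x + r • b ∈ closure Ω}

/-! ### The final time boundary value problem -/

/-- The data of the Bellman problem with mixed boundary conditions. -/
structure Problem (d : ℕ) (A : Type*) [MetricSpace A] where
  /-- the open domain -/
  Ω : Set (E d)
  /-- Dirichlet boundary -/
  ΓD : Set (E d)
  /-- Robin boundary without time derivative -/
  ΓR : Set (E d)
  /-- Robin boundary with time derivative -/
  Γt : Set (E d)
  /-- final time -/
  T : ℝ
  a : A → E d → ℝ
  b : A → E d → E d
  c : A → E d → ℝ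
  f : A → E d → ℝ
  /-- first order coefficient of the Robin operator -/
  bB : A → E d → E d
  /-- zeroth order coefficient of the Robin operator -/
  cB : A → E d → ℝ
  /-- Robin data -/
  gB : A → E d → ℝ
  /-- Dirichlet data -/
  g : E d → ℝ
  /-- final time data -/
  vT : E d → ℝ
  domain : IsPolytopicDomain Ω
  disjoint_DR : Disjoint ΓD ΓR
  disjoint_Dt : Disjoint ΓD Γt
  disjoint_Rt : Disjoint ΓR Γt
  boundary_eq : ΓD ∪ ΓR ∪ Γt = frontier Ω
  T_pos : 0 < T
  a_cont : ∀ α, ContinuousOn (a α) (closure Ω)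
  b_cont : ∀ α, ContinuousOn (b α) (closure Ω)
  c_cont : ∀ α, ContinuousOn (c α) (closure Ω)
  f_cont : ∀ α, ContinuousOn (f α) (closure Ω)
  a_family : ContinuousFamily (closure Ω) a
  b_family : ContinuousFamily (closure Ω) b
  c_family : ContinuousFamily (closure Ω) c
  f_family : ContinuousFamily (closure Ω) f
  bB_pc : ∀ α, IsPC Ω ΓD ΓR Γt (bB α)
  cB_pc : ∀ α, IsPC Ω ΓD ΓR Γt (cB α)
  gB_pc : ∀ α, IsPC Ω ΓD ΓR Γt (gB α)
  bB_family : ContinuousFamily (frontier Ω) bB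
  cB_family : ContinuousFamily (frontier Ω) cB
  gB_family : ContinuousFamily (frontier Ω) gB
  g_cont : ContinuousOn g (frontier Ω)
  vT_cont : ContinuousOn vT (closure Ω)
  a_nonneg : ∀ α, ∀ x ∈ closure Ω, 0 ≤ a α x
  c_nonneg : ∀ α, ∀ x ∈ closure Ω, 0 ≤ c α x
  cB_nonneg : ∀ α, ∀ x ∈ frontier Ω, 0 ≤ cB α x
  gB_nonneg : ∀ α, ∀ x ∈ frontier Ω, 0 ≤ gB α x
  g_nonneg : ∀ x ∈ frontier Ω, 0 ≤ g x
  vT_nonneg : ∀ x ∈ closure Ω, 0 ≤ vT x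
  vT_dirichlet : ∀ x ∈ ΓD, vT x = g x
  bB_cone : ∀ α, ∀ x ∈ frontier Ω, bB α x ∈ tangentCone Ω x

namespace Problem

variable {d : ℕ} {A : Type*} [MetricSpace A] (pb : Problem d A)

/-- The operator `L^α(x,q,p,s)`. -/
def L (α : A) (x : E d) (q : ℝ) (p : E d) (s : ℝ) : ℝ :=
  -(pb.a α x * q) - inner ℝ (pb.b α x) p + pb.c α x * s

/-- The Robin operator `L_{∂Ω}^α(x,p,s)`. -/
def LB (α : A) (x : E d) (p : E d) (s : ℝ) : ℝ :=
  -(inner ℝ (pb.bB α x) p) + pb.cB α x * s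

open Classical in
/-- The operator `F(t,x,q,p,r,s)` of the final time boundary value problem; only its values for
`(t,x) ∈ [0,T] × closure Ω` matter. -/
def F : ℝ × E d × ℝ × E d × ℝ × ℝ → ℝ := fun (t, x, q, p, r, s) =>
  if t = pb.T then s - pb.vT x
  else if x ∈ pb.Ω then -r + ⨆ α, (pb.L α x q p s - pb.f α x)
  else if x ∈ pb.Γt then -r + ⨆ α, (pb.LB α x p s - pb.gB α x)
  else if x ∈ pb.ΓR then ⨆ α, (pb.LB α x p s - pb.gB α x)
  else s - pb.g x

/-- The arguments `(t,x,q,p,r,s)` of `F` with `(t,x) ∈ [0,T] × closure Ω`. -/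
def argSet : Set (ℝ × E d × ℝ × E d × ℝ × ℝ) :=
  {z | z.1 ∈ Icc 0 pb.T ∧ z.2.1 ∈ closure pb.Ω}

/-- The upper semicontinuous envelope `F^*`. -/
def upperF (z : ℝ × E d × ℝ × E d × ℝ × ℝ) : EReal :=
  limsup (fun z' => ((pb.F z' : ℝ) : EReal)) (𝓝[pb.argSet] z)

/-- The lower semicontinuous envelope `F_*`. -/
def lowerF (z : ℝ × E d × ℝ × E d × ℝ × ℝ) : EReal :=
  liminf (fun z' => ((pb.F z' : ℝ) : EReal)) (𝓝[pb.argSet] z)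

end Problem

/-! ### Meshes and finite element spaces -/

/-- The `d`-dimensional elements (closed simplices) of a simplicial complex. -/
def elements {d : ℕ} (K : Geometry.SimplicialComplex ℝ (E d)) : Set (Set (E d)) :=
  {k | ∃ s ∈ K.faces, s.card = d + 1 ∧ k = convexHull ℝ (s : Set (E d))}

/-- The largest diameter of an element. -/
def meshSize {d : ℕ} (K : Geometry.SimplicialComplex ℝ (E d)) : ℝ :=
  sSup (Metric.diam '' elements K)

/-- The open boundary faces: relative interiors of the `(d-1)`-dimensional simplices of the mesh
that lie in the boundary of `Ω`. -/
def boundaryMesh {d : ℕ} (Ω : Set (E d)) (K : Geometry.SimplicialComplex ℝ (E d)) :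
    Set (Set (E d)) :=
  {e | ∃ s ∈ K.faces, s.card = d ∧ convexHull ℝ (s : Set (E d)) ⊆ frontier Ω ∧
    e = intrinsicInterior ℝ (convexHull ℝ (s : Set (E d)))}

/-- `K` is a (conforming, finite) simplicial mesh of `closure Ω` whose boundary mesh is subordinate
to the generalised faces. -/
structure IsMesh {d : ℕ} (Ω ΓD ΓR Γt : Set (E d)) (K : Geometry.SimplicialComplex ℝ (E d)) :
    Prop where
  finite : K.faces.Finite
  pure : ∀ s ∈ K.faces, ∃ s' ∈ K.faces, s ⊆ s' ∧ s'.card = d + 1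
  space_eq : K.space = closure Ω
  subordinate : ∀ e ∈ boundaryMesh Ω K, ∃! ω, ω ∈ generalisedFaces Ω ΓD ΓR Γt ∧ e ⊆ ω

/-- The space of continuous functions on the meshed set which are affine on every element.
To be able to speak of functions on `ℝ^d`, they are extended by zero. -/
def P1 {d : ℕ} (K : Geometry.SimplicialComplex ℝ (E d)) : Submodule ℝ (E d → ℝ) where
  carrier := {w | ContinuousOn w K.space ∧
    (∀ k ∈ elements K, ∃ l : E d →ᵃ[ℝ] ℝ, EqOn w l k) ∧ ∀ x ∉ K.space, w x = 0}
  add_mem' := by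
    rintro u v ⟨hu, hu', hu''⟩ ⟨hv, hv', hv''⟩
    refine ⟨hu.add hv, fun k hk => ?_, fun x hx => by simp [hu'' x hx, hv'' x hx]⟩
    obtain ⟨l, hl⟩ := hu' k hk
    obtain ⟨m, hm⟩ := hv' k hk
    exact ⟨l + m, fun x hx => by simp [hl hx, hm hx]⟩
  zero_mem' := ⟨continuousOn_const, fun k _ => ⟨0, fun x _ => by simp⟩, fun x _ => rfl⟩
  smul_mem' := by
    rintro r u ⟨hu, hu', hu''⟩
    refine ⟨hu.const_smul r, fun k hk => ?_, fun x hx => by simp [hu'' x hx]⟩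
    obtain ⟨l, hl⟩ := hu' k hk
    exact ⟨r • l, fun x hx => by simp [hl hx]⟩

/-- The nodal hat functions: `φ y` is the element of the finite element space which is `1` at the
node `y` and `0` at all other nodes. -/
def IsHatFamily {d : ℕ} (K : Geometry.SimplicialComplex ℝ (E d)) (φ : E d → E d → ℝ) : Prop :=
  ∀ y ∈ K.vertices, φ y ∈ P1 K ∧ φ y y = 1 ∧ ∀ z ∈ K.vertices, z ≠ y → φ y z = 0

/-- The lower Dini derivative `∂_{-b} w(y)`. -/
def dini {d : ℕ} (b : E d) (w : E d → ℝ) (y : E d) : ℝ :=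
  liminf (fun r : ℝ => (w y - w (y + r • b)) / r) (𝓝[>] 0)

/-! ### The discretisation -/

/-- A sequence of discretisations. The suffix `E` marks the explicit and `I` the implicit part of
a coefficient; `B` marks the coefficients of the Robin operators. -/
structure Scheme {d : ℕ} {A : Type*} [MetricSpace A] (pb : Problem d A) where
  mesh : ℕ → Geometry.SimplicialComplex ℝ (E d)
  /-- hat functions -/
  φ : ℕ → E d → E d → ℝ
  /-- time step size -/
  h : ℕ → ℝ
  /-- number of time steps, `T / h` -/
  steps : ℕ → ℕ
  aE : ℕ → A → E d → ℝ
  aI : ℕ → A → E d → ℝ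
  bE : ℕ → A → E d → E d
  bI : ℕ → A → E d → E d
  cE : ℕ → A → E d → ℝ
  cI : ℕ → A → E d → ℝ
  f : ℕ → A → E d → ℝ
  bBE : ℕ → A → E d → E d
  bBI : ℕ → A → E d → E d
  cBE : ℕ → A → E d → ℝ
  cBI : ℕ → A → E d → ℝ
  gB : ℕ → A → E d → ℝ
  -- meshes and time steps
  isMesh : ∀ i, IsMesh pb.Ω pb.ΓD pb.ΓR pb.Γt (mesh i)
  isHat : ∀ i, IsHatFamily (mesh i) (φ i)
  shape_regular : ∃ σ : ℝ, ∀ i, ∀ k ∈ elements (mesh i), ∃ z ρ, 0 < ρ ∧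
    Metric.closedBall z ρ ⊆ k ∧ Metric.diam k ≤ σ * ρ
  meshSize_tendsto : Tendsto (fun i => meshSize (mesh i)) atTop (𝓝 0)
  h_pos : ∀ i, 0 < h i
  h_steps : ∀ i, steps i * h i = pb.T
  h_tendsto : Tendsto h atTop (𝓝 0)
  -- regularity of the coefficients
  aE_cont : ∀ i α, ContinuousOn (aE i α) (closure pb.Ω)
  aI_cont : ∀ i α, ContinuousOn (aI i α) (closure pb.Ω)
  bE_cont : ∀ i α, ContinuousOn (bE i α) (closure pb.Ω)
  bI_cont : ∀ i α, ContinuousOn (bI i α) (closure pb.Ω)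
  cE_cont : ∀ i α, ContinuousOn (cE i α) (closure pb.Ω)
  cI_cont : ∀ i α, ContinuousOn (cI i α) (closure pb.Ω)
  f_cont : ∀ i α, ContinuousOn (f i α) (closure pb.Ω)
  f_nonneg : ∀ i α, ∀ x ∈ closure pb.Ω, 0 ≤ f i α x
  bBE_pc : ∀ i α, IsPC pb.Ω pb.ΓD pb.ΓR pb.Γt (bBE i α)
  bBI_pc : ∀ i α, IsPC pb.Ω pb.ΓD pb.ΓR pb.Γt (bBI i α)
  cBE_pc : ∀ i α, IsPC pb.Ω pb.ΓD pb.ΓR pb.Γt (cBE i α)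
  cBI_pc : ∀ i α, IsPC pb.Ω pb.ΓD pb.ΓR pb.Γt (cBI i α)
  gB_pc : ∀ i α, IsPC pb.Ω pb.ΓD pb.ΓR pb.Γt (gB i α)
  aE_family : ∀ i, ContinuousFamily (closure pb.Ω) (aE i)
  aI_family : ∀ i, ContinuousFamily (closure pb.Ω) (aI i)
  bE_family : ∀ i, ContinuousFamily (closure pb.Ω) (bE i)
  bI_family : ∀ i, ContinuousFamily (closure pb.Ω) (bI i)
  cE_family : ∀ i, ContinuousFamily (closure pb.Ω) (cE i)
  cI_family : ∀ i, ContinuousFamily (closure pb.Ω) (cI i)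
  f_family : ∀ i, ContinuousFamily (closure pb.Ω) (f i)
  bBE_family : ∀ i, ContinuousFamily (frontier pb.Ω) (bBE i)
  bBI_family : ∀ i, ContinuousFamily (frontier pb.Ω) (bBI i)
  cBE_family : ∀ i, ContinuousFamily (frontier pb.Ω) (cBE i)
  cBI_family : ∀ i, ContinuousFamily (frontier pb.Ω) (cBI i)
  gB_family : ∀ i, ContinuousFamily (frontier pb.Ω) (gB i)
  -- the coefficients are bounded uniformly in `i` and `α`
  bounded : ∃ M : ℝ, ∀ i α,
    (∀ x ∈ closure pb.Ω, |aE i α x| ≤ M ∧ |aI i α x| ≤ M ∧ ‖bE i α x‖ ≤ M ∧ ‖bI i α x‖ ≤ M ∧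
      |cE i α x| ≤ M ∧ |cI i α x| ≤ M) ∧
    (∀ x ∈ frontier pb.Ω, ‖bBE i α x‖ ≤ M ∧ ‖bBI i α x‖ ≤ M ∧
      |cBE i α x| ≤ M ∧ |cBI i α x| ≤ M)
  -- the split coefficients approximate the coefficients of the problem
  a_conv : ∀ ε > 0, ∀ᶠ i in atTop, ∀ α, ∀ y ∈ (mesh i).vertices, y ∉ pb.ΓD →
    ∀ x ∈ tsupport (φ i y), |pb.a α x - (aE i α y + aI i α y)| ≤ ε
  b_conv : ConvergesUniformly (closure pb.Ω) (fun i α x => bE i α x + bI i α x) pb.b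
  c_conv : ConvergesUniformly (closure pb.Ω) (fun i α x => cE i α x + cI i α x) pb.c
  f_conv : ConvergesUniformly (closure pb.Ω) f pb.f
  bB_conv : ConvergesUniformly (frontier pb.Ω) (fun i α x => bBE i α x + bBI i α x) pb.bB
  cB_conv : ConvergesUniformly (frontier pb.Ω) (fun i α x => cBE i α x + cBI i α x) pb.cB
  gB_conv : ConvergesUniformly (frontier pb.Ω) gB pb.gB
  -- the Dini derivatives at Robin nodes refer to directions in the tangent cone
  bBE_cone : ∀ i α, ∀ y ∈ (mesh i).vertices, y ∈ pb.Γt ∪ pb.ΓR → bBE i α y ∈ tangentCone pb.Ω y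
  bBI_cone : ∀ i α, ∀ y ∈ (mesh i).vertices, y ∈ pb.Γt ∪ pb.ΓR → bBI i α y ∈ tangentCone pb.Ω y
  -- fully implicit discretisation on the Robin boundary without time derivative
  implicit_R : ∀ i α, ∀ x ∈ pb.ΓR, bBE i α x = 0 ∧ cBE i α x = 0 ∧ 0 < cBI i α x

namespace Scheme

variable {d : ℕ} {A : Type*} [MetricSpace A] {pb : Problem d A} (D : Scheme pb)

/-- The finite element space `V_i`. -/
abbrev V (i : ℕ) : Submodule ℝ (E d → ℝ) := P1 (D.mesh i)

/-- The `k`-th time step. -/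
def s (i k : ℕ) : ℝ := k * D.h i

/-- The hat function at `y`, normalised in `L¹(Ω)`. -/
def φhat (i : ℕ) (y : E d) : E d → ℝ := fun x => D.φ i y x / ∫ z in pb.Ω, |D.φ i y z|

/-- `⟨∇u, ∇v⟩` in `L²(Ω, ℝ^d)`. Functions in `V_i` are differentiable off the null set of
element boundaries. -/
def gradInner (pb : Problem d A) (u v : E d → ℝ) : ℝ :=
  ∫ x in pb.Ω, inner ℝ (gradient u x) (gradient v x)

/-- `a ⟨∇w, ∇η⟩ + ⟨-b ⬝ ∇w + c w, η⟩` -/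
def weakForm (pb : Problem d A) (a : ℝ) (b : E d → E d) (c : E d → ℝ) (w η : E d → ℝ) : ℝ :=
  a * gradInner pb w η + ∫ x in pb.Ω, (-(inner ℝ (b x) (gradient w x)) + c x * w x) * η x

open Classical in
/-- Explicit operator on the domain, row of the node `y`. -/
def opEΩ (i : ℕ) (α : A) (w : E d → ℝ) (y : E d) : ℝ :=
  if y ∈ pb.Ω then weakForm pb (D.aE i α y) (D.bE i α) (D.cE i α) w (D.φhat i y) else 0

open Classical in
/-- Implicit operator on the domain, row of the node `y`. -/
def opIΩ (i : ℕ) (α : A) (w : E d → ℝ) (y : E d) : ℝ :=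
  if y ∈ pb.Ω then weakForm pb (D.aI i α y) (D.bI i α) (D.cI i α) w (D.φhat i y) else 0

open Classical in
/-- Right-hand side on the domain, row of the node `y`. -/
def opFΩ (i : ℕ) (α : A) (y : E d) : ℝ :=
  if y ∈ pb.Ω then ∫ x in pb.Ω, D.f i α x * D.φhat i y x else 0

open Classical in
/-- Explicit operator on the boundary, row of the node `y`. -/
def opEB (i : ℕ) (α : A) (w : E d → ℝ) (y : E d) : ℝ :=
  if y ∈ pb.Γt ∪ pb.ΓR then dini (D.bBE i α y) w y + D.cBE i α y * w y else 0

open Classical in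
/-- Implicit operator on the boundary, row of the node `y`; nodal interpolation on `ΓD`. -/
def opIB (i : ℕ) (α : A) (w : E d → ℝ) (y : E d) : ℝ :=
  if y ∈ pb.Γt ∪ pb.ΓR then dini (D.bBI i α y) w y + D.cBI i α y * w y
  else if y ∈ pb.ΓD then w y else 0

open Classical in
/-- Right-hand side on the boundary, row of the node `y`. -/
def opFB (i : ℕ) (α : A) (y : E d) : ℝ :=
  if y ∈ pb.Γt ∪ pb.ΓR then D.gB i α y else if y ∈ pb.ΓD then pb.g y else 0

/-- `E_i^α` -/
def opE (i : ℕ) (α : A) (w : E d → ℝ) (y : E d) : ℝ := D.opEΩ i α w y + D.opEB i α w y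

/-- `I_i^α` -/
def opI (i : ℕ) (α : A) (w : E d → ℝ) (y : E d) : ℝ := D.opIΩ i α w y + D.opIB i α w y

/-- `F_i^α` -/
def opF (i : ℕ) (α : A) (y : E d) : ℝ := D.opFΩ i α y + D.opFB i α y

open Classical in
/-- The discrete time derivative `d_i w(s_i^k, y)`, which vanishes on `ΓR` and `ΓD`. -/
def dt (i : ℕ) (w : ℝ → E d → ℝ) (k : ℕ) (y : E d) : ℝ :=
  if y ∈ pb.Ω ∪ pb.Γt then (w (D.s i (k + 1)) y - w (D.s i k) y) / D.h i else 0

/-- The operator of the numerical scheme,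
`F_i w = -d_i w + sup_α (E_i^α w(s_i^{k+1}) + I_i^α w(s_i^k) - F_i^α)`, at the node `(s_i^k, y)`. -/
def discreteF (i : ℕ) (w : ℝ → E d → ℝ) (k : ℕ) (y : E d) : ℝ :=
  -(D.dt i w k y) +
    ⨆ α, (D.opE i α (w (D.s i (k + 1))) y + D.opI i α (w (D.s i k)) y - D.opF i α y)

end Scheme

/-! ### Elliptic projections -/

/-- The `C²` functions on `ℝ^d`. -/
def C2 (d : ℕ) : Submodule ℝ (E d → ℝ) where
  carrier := {w | ContDiff ℝ 2 w}
  add_mem' := by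
    intro u v hu hv
    rw [Set.mem_ofPred_eq] at *
    exact hu.add hv
  zero_mem' := by
    rw [Set.mem_ofPred_eq]
    exact contDiff_const
  smul_mem' := by
    intro r u hu
    rw [Set.mem_ofPred_eq] at *
    exact hu.const_smul r

/-- The `W^{1,∞}(Ω)` norm of a function that is locally Lipschitz in `Ω`: for such functions the
weak gradient is the almost everywhere defined classical gradient. -/
def W1inf {d : ℕ} (Ω : Set (E d)) (w : E d → ℝ) : ℝ≥0∞ :=
  eLpNorm w ∞ (volume.restrict Ω) + eLpNorm (gradient w) ∞ (volume.restrict Ω)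

/-- A family of elliptic projections onto the spaces `V_i`. -/
structure EllipticProjection {d : ℕ} {A : Type*} [MetricSpace A] {pb : Problem d A}
    (D : Scheme pb) where
  P : ∀ i, C2 d →ₗ[ℝ] D.V i
  /-- orthogonality at the interior nodes -/
  orthogonal : ∀ i (w : C2 d), ∀ y ∈ (D.mesh i).vertices, y ∈ pb.Ω →
    Scheme.gradInner pb (P i w : E d → ℝ) (D.φhat i y) =
      Scheme.gradInner pb (w : E d → ℝ) (D.φhat i y)
  /-- each single `P_i` is continuous -/
  continuous : ∀ i, ∃ C : ℝ≥0, ∀ w : C2 d,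
    W1inf pb.Ω (P i w : E d → ℝ) ≤ C * W1inf pb.Ω (w : E d → ℝ)
  /-- stability, uniformly in `i`, on smooth functions -/
  stable : ∃ C : ℝ≥0, ∀ i (w : C2 d), ContDiff ℝ ((⊤ : ℕ∞) : WithTop ℕ∞) (w : E d → ℝ) →
    W1inf pb.Ω (P i w : E d → ℝ) ≤ C * W1inf pb.Ω (w : E d → ℝ)
  /-- convergence on smooth functions -/
  tendsto : ∀ w : C2 d, ContDiff ℝ ((⊤ : ℕ∞) : WithTop ℕ∞) (w : E d → ℝ) →
    Tendsto (fun i => W1inf pb.Ω ((P i w : E d → ℝ) - (w : E d → ℝ))) atTop (𝓝 0)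

/-- `ψ(s, ·)` as a `C²` function on `ℝ^d`. -/
def slice {d : ℕ} (ψ : ℝ × E d → ℝ) (hψ : ContDiff ℝ 2 ψ) (s : ℝ) : C2 d :=
  ⟨fun x => ψ (s, x), hψ.comp (contDiff_const.prodMk contDiff_id)⟩

/-- `P_i ψ`, with `P_i` applied at each time separately. -/
def EllipticProjection.apply {d : ℕ} {A : Type*} [MetricSpace A] {pb : Problem d A}
    {D : Scheme pb} (Q : EllipticProjection D) (i : ℕ) (ψ : ℝ × E d → ℝ)
    (hψ : ContDiff ℝ 2 ψ) : ℝ → E d → ℝ :=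
  fun s => (Q.P i (slice ψ hψ s) : E d → ℝ)

/-- `(t, x, Δψ(t,x), ∇ψ(t,x), ∂_tψ(t,x), ψ(t,x))` -/
def jet {d : ℕ} (ψ : ℝ × E d → ℝ) (t : ℝ) (x : E d) : ℝ × E d × ℝ × E d × ℝ × ℝ :=
  (t, x, Laplacian.laplacian (fun z => ψ (t, z)) x, gradient (fun z => ψ (t, z)) x,
    deriv (fun s => ψ (s, x)) t, ψ (t, x))

end HJB

end

/-!
`F_i P_i ψ (s_i^{k(i)}, y_i^{ℓ(i)})` differs by a null sequence from `F` evaluated at the time `t`,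
the point `y_i^{ℓ(i)}` and the derivatives of `ψ` at `(t, x)`. These arguments converge to the jet
of `ψ` at `(t, x)`, so both claims follow from the definition of the envelopes.

The stability of the `P_i` on smooth functions extends to `C²` by the continuity of each `P_i` and
the density of smooth functions, and hence `P_i w_i → u` in `W^{1,∞}` whenever `w_i → u` in `C¹`.
* At an interior node the lower-order terms are averages against normalised hats. In the
  second-order term the orthogonality of `P_i` replaces `P_i w` by `w`, and integration by parts
  turns it into an average of `-Δw`, since the hat of an interior node vanishes outside `Ω`.
* At a boundary node a direction in the tangent cone stays for a while in a single mesh element, so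
  the Dini derivative is a directional derivative of the affine function on that element. Its
  gradient is controlled in `L^∞`, because elements have positive measure.
-/

namespace HJB

section Mesh

variable {d : ℕ} {K : Geometry.SimplicialComplex ℝ (E d)} {Ω ΓD ΓR Γt : Set (E d)}

theorem isCompact_of_mem_elements {k : Set (E d)} (hk : k ∈ elements K) : IsCompact k := by
  obtain ⟨s, -, -, rfl⟩ := hk
  exact s.finite_toSet.isCompact_convexHull ℝ

theorem convex_of_mem_elements {k : Set (E d)} (hk : k ∈ elements K) : Convex ℝ k := by
  obtain ⟨s, -, -, rfl⟩ := hk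
  exact convex_convexHull ℝ _

theorem subset_space_of_mem_elements {k : Set (E d)} (hk : k ∈ elements K) : k ⊆ K.space := by
  obtain ⟨s, hs, -, rfl⟩ := hk
  exact Geometry.SimplicialComplex.convexHull_subset_space hs

theorem interior_nonempty_of_mem_elements {k : Set (E d)} (hk : k ∈ elements K) :
    (interior k).Nonempty := by
  obtain ⟨s, hs, hc, rfl⟩ := hk
  rw [interior_convexHull_nonempty_iff_affineSpan_eq_top]
  simpa using (K.indep hs).affineSpan_eq_top_iff_card_eq_finrank_add_one.2 (by simp [hc])

theorem IsMesh.exists_face_of_mem_space (hK : IsMesh Ω ΓD ΓR Γt K) {x : E d} (hx : x ∈ K.space) :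
    ∃ s ∈ K.faces, s.card = d + 1 ∧ x ∈ convexHull ℝ (s : Set (E d)) := by
  obtain ⟨s, hs, hxs⟩ := Geometry.SimplicialComplex.mem_space_iff.1 hx
  obtain ⟨s', hs', hss', hc⟩ := hK.pure s hs
  exact ⟨s', hs', hc, convexHull_mono (Finset.coe_subset.2 hss') hxs⟩

theorem IsMesh.space_eq_sUnion (hK : IsMesh Ω ΓD ΓR Γt K) : K.space = ⋃₀ elements K := by
  refine Subset.antisymm (fun x hx => ?_) (sUnion_subset fun k => subset_space_of_mem_elements)
  obtain ⟨s, hs, hc, hxs⟩ := hK.exists_face_of_mem_space hx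
  exact ⟨_, ⟨s, hs, hc, rfl⟩, hxs⟩

theorem IsMesh.finite_elements (hK : IsMesh Ω ΓD ΓR Γt K) : (elements K).Finite := by
  refine (hK.finite.image fun s : Finset (E d) => convexHull ℝ (s : Set (E d))).subset ?_
  rintro _ ⟨s, hs, -, rfl⟩
  exact ⟨s, hs, rfl⟩

theorem IsMesh.interior_element_subset (hK : IsMesh Ω ΓD ΓR Γt K)
    (hΩ : interior (closure Ω) = Ω) {k : Set (E d)} (hk : k ∈ elements K) : interior k ⊆ Ω := by
  rw [← hΩ, ← hK.space_eq]
  exact interior_mono (subset_space_of_mem_elements hk)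

theorem IsMesh.dist_le_meshSize (hK : IsMesh Ω ΓD ΓR Γt K) {k : Set (E d)}
    (hk : k ∈ elements K) {x z : E d} (hx : x ∈ k) (hz : z ∈ k) : dist x z ≤ meshSize K :=
  (Metric.dist_le_diam_of_mem (isCompact_of_mem_elements hk).isBounded hx hz).trans
    (le_csSup (hK.finite_elements.image _).bddAbove ⟨k, hk, rfl⟩)

theorem IsMesh.ae_mem_interior_element (hK : IsMesh Ω ΓD ΓR Γt K) :
    ∀ᵐ x ∂(volume.restrict (closure Ω)), ∃ k ∈ elements K, x ∈ interior k := by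
  have h_frontier : volume (⋃ k ∈ elements K, frontier k) = 0 := by
    rw [measure_biUnion_null_iff hK.finite_elements.countable]
    exact fun k hk => (convex_of_mem_elements hk).addHaar_frontier volume
  rw [ae_restrict_iff' isClosed_closure.measurableSet]
  filter_upwards [measure_eq_zero_iff_ae_notMem.1 h_frontier] with x hx hxΩ
  rw [← hK.space_eq, hK.space_eq_sUnion] at hxΩ
  obtain ⟨k, hk, hxk⟩ := hxΩ
  refine ⟨k, hk, by_contra fun hxi => hx (mem_biUnion hk ⟨subset_closure hxk, hxi⟩)⟩

/-- The gradient of an affine function. -/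
noncomputable def affineGradient (l : E d →ᵃ[ℝ] ℝ) : E d :=
  (InnerProductSpace.toDual ℝ (E d)).symm (LinearMap.toContinuousLinearMap l.linear)

theorem affineMap_add (l : E d →ᵃ[ℝ] ℝ) (y v : E d) :
    l (y + v) = l y + inner ℝ (affineGradient l) v := by
  rw [add_comm y v, ← vadd_eq_add, l.map_vadd]
  simp [affineGradient, add_comm]

theorem hasGradientAt_affineMap (l : E d →ᵃ[ℝ] ℝ) (x : E d) :
    HasGradientAt l (affineGradient l) x := by
  rw [hasGradientAt_iff_hasFDerivAt, l.decomp]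
  refine HasFDerivAt.add_const (l 0) ?_
  simpa [affineGradient] using (LinearMap.toContinuousLinearMap l.linear).hasFDerivAt

theorem hasGradientAt_of_eqOn_affineMap {w : E d → ℝ} {l : E d →ᵃ[ℝ] ℝ} {k : Set (E d)}
    (h : EqOn w l k) {x : E d} (hx : x ∈ interior k) : HasGradientAt w (affineGradient l) x :=
  (hasGradientAt_affineMap l x).congr_of_eventuallyEq
    (h.eventuallyEq_of_mem (mem_interior_iff_mem_nhds.1 hx))

theorem IsMesh.ae_differentiableAt (hK : IsMesh Ω ΓD ΓR Γt K) {w : E d → ℝ} (hw : w ∈ P1 K) :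
    ∀ᵐ x ∂(volume.restrict (closure Ω)), DifferentiableAt ℝ w x := by
  filter_upwards [hK.ae_mem_interior_element] with x ⟨k, hk, hx⟩
  obtain ⟨l, hl⟩ := hw.2.1 k hk
  exact (hasGradientAt_of_eqOn_affineMap hl hx).differentiableAt

theorem exists_mem_frequently_nhdsGT_of_finite_closed_cover {X : Type*} [TopologicalSpace X]
    {𝒦 : Set (Set X)} (h_fin : 𝒦.Finite) (h_closed : ∀ k ∈ 𝒦, IsClosed k) {γ : ℝ → X}
    (hγ : Continuous γ) {r : ℝ} (h_cover : ∃ᶠ ρ in 𝓝[>] r, γ ρ ∈ ⋃₀ 𝒦) :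
    ∃ k ∈ 𝒦, γ r ∈ k ∧ ∃ᶠ ρ in 𝓝[>] r, γ ρ ∈ k := by
  obtain ⟨k, hk, hfr⟩ : ∃ k ∈ 𝒦, ∃ᶠ ρ in 𝓝[>] r, γ ρ ∈ k := by
    by_contra! h
    refine h_cover (((eventually_all_finite h_fin).2 h).mono ?_)
    rintro ρ hρ ⟨k, hk, hρk⟩
    exact hρ k hk hρk
  have h_mem : r ∈ closure (γ ⁻¹' k) :=
    mem_closure_iff_frequently.2 (hfr.filter_mono nhdsWithin_le_nhds)
  rw [((h_closed k hk).preimage hγ).closure_eq] at h_mem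
  exact ⟨k, hk, h_mem, hfr⟩

theorem exists_mem_forall_Icc_add_smul_mem {V : Type*} [NormedAddCommGroup V] [NormedSpace ℝ V]
    {𝒦 : Set (Set V)} (h_fin : 𝒦.Finite) (h_closed : ∀ k ∈ 𝒦, IsClosed k)
    (h_convex : ∀ k ∈ 𝒦, Convex ℝ k) {y b : V} {Λ : ℝ} (hΛ : 0 < Λ)
    (h_cover : ∀ r ∈ Icc 0 Λ, y + r • b ∈ ⋃₀ 𝒦) :
    ∃ k ∈ 𝒦, ∃ r : ℝ, 0 < r ∧ ∀ ρ ∈ Icc 0 r, y + ρ • b ∈ k := by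
  have h_ev : ∀ᶠ r in 𝓝[>] (0 : ℝ), y + r • b ∈ ⋃₀ 𝒦 := by
    filter_upwards [Ioc_mem_nhdsGT hΛ] with r hr using h_cover r ⟨hr.1.le, hr.2⟩
  obtain ⟨k, hk, hy, hfr⟩ := exists_mem_frequently_nhdsGT_of_finite_closed_cover h_fin h_closed
    (γ := fun r => y + r • b) (by fun_prop) h_ev.frequently
  rw [zero_smul, add_zero] at hy
  obtain ⟨r, hrk, hr : 0 < r⟩ := (hfr.and_eventually self_mem_nhdsWithin).exists
  refine ⟨k, hk, r, hr, fun ρ hρ => ?_⟩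
  have hρk := (h_convex k hk).add_smul_sub_mem hy hrk (t := ρ / r)
    ⟨div_nonneg hρ.1 hr.le, div_le_one_of_le₀ hρ.2 hr.le⟩
  rwa [add_sub_cancel_left, smul_smul, div_mul_cancel₀ _ hr.ne'] at hρk

theorem IsMesh.exists_element_dini_eq (hK : IsMesh Ω ΓD ΓR Γt K) {y b : E d}
    (hb : b ∈ tangentCone Ω y) :
    ∃ k ∈ elements K, y ∈ k ∧ ∀ (w : E d → ℝ) (l : E d →ᵃ[ℝ] ℝ), EqOn w l k →
      dini b w y = -inner ℝ (affineGradient l) b := by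
  obtain ⟨Λ, hΛ, h_ray⟩ := hb
  rw [← hK.space_eq, hK.space_eq_sUnion] at h_ray
  obtain ⟨k, hk, r, hr, hkr⟩ := exists_mem_forall_Icc_add_smul_mem hK.finite_elements
    (fun k hk => (isCompact_of_mem_elements hk).isClosed) (fun k hk => convex_of_mem_elements hk)
    hΛ h_ray
  have hy : y ∈ k := by simpa using hkr 0 ⟨le_rfl, hr.le⟩
  refine ⟨k, hk, hy, fun w l hl => ?_⟩
  have h_quot : (fun ρ : ℝ => (w y - w (y + ρ • b)) / ρ) =ᶠ[𝓝[>] 0]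
      fun _ => -inner ℝ (affineGradient l) b := by
    filter_upwards [Ioc_mem_nhdsGT hr] with ρ hρ
    rw [hl hy, hl (hkr ρ ⟨hρ.1.le, hρ.2⟩), affineMap_add, inner_smul_right, sub_add_cancel_left,
      neg_div, mul_div_cancel_left₀ _ hρ.1.ne']
  rw [dini, liminf_congr h_quot, liminf_const]

end Mesh

section Hat

variable {d : ℕ} {K : Geometry.SimplicialComplex ℝ (E d)} {Ω ΓD ΓR Γt : Set (E d)}
  {φ : E d → E d → ℝ} {y : E d}

theorem IsHatFamily.apply_sum (hφ : IsHatFamily K φ) (hy : y ∈ K.vertices) {s : Finset (E d)}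
    (hs : s ∈ K.faces) (hc : s.card = d + 1) {w : E d → ℝ} (hw0 : ∀ p ∈ s, 0 ≤ w p)
    (hw : ∑ p ∈ s, w p = 1) [Decidable (y ∈ s)] :
    φ y (∑ p ∈ s, w p • p) = if y ∈ s then w y else 0 := by
  classical
  obtain ⟨hP, h_one, h_zero⟩ := hφ y hy
  obtain ⟨l, hl⟩ := hP.2.1 _ ⟨s, hs, hc, rfl⟩
  have hl_vertex : ∀ p ∈ s, l p = if p = y then 1 else 0 := by
    intro p hp
    rw [← hl (subset_convexHull ℝ _ hp)]
    split_ifs with hpy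
    · rw [hpy, h_one]
    · exact h_zero p (K.down_closed hs (Finset.singleton_subset_iff.2 hp) ⟨p, by simp⟩) hpy
  calc φ y (∑ p ∈ s, w p • p) = l (s.affineCombination ℝ id w) := by
        rw [hl (Finset.mem_convexHull'.2 ⟨w, hw0, hw, rfl⟩),
          s.affineCombination_eq_linear_combination id w hw]
        simp only [id]
    _ = ∑ p ∈ s, w p • l p := by
        rw [s.map_affineCombination id w hw, s.affineCombination_eq_linear_combination _ w hw]
        simp only [Function.comp_apply, id]
    _ = if y ∈ s then w y else 0 := by
        rw [Finset.sum_congr rfl fun p hp => by rw [hl_vertex p hp]]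
        simp

theorem IsMesh.hat_nonneg (hK : IsMesh Ω ΓD ΓR Γt K) (hφ : IsHatFamily K φ)
    (hy : y ∈ K.vertices) (x : E d) : 0 ≤ φ y x := by
  classical
  by_cases hx : x ∈ K.space
  · obtain ⟨s, hs, hc, hxs⟩ := hK.exists_face_of_mem_space hx
    obtain ⟨w, hw0, hw, rfl⟩ := Finset.mem_convexHull'.1 hxs
    rw [hφ.apply_sum hy hs hc hw0 hw]
    split_ifs with h
    exacts [hw0 _ h, le_rfl]
  · exact ((hφ y hy).1.2.2 x hx).ge

theorem IsMesh.exists_element_of_hat_ne_zero (hK : IsMesh Ω ΓD ΓR Γt K) (hφ : IsHatFamily K φ)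
    (hy : y ∈ K.vertices) {x : E d} (hx : φ y x ≠ 0) :
    ∃ k ∈ elements K, y ∈ k ∧ x ∈ k := by
  classical
  have hxK : x ∈ K.space := by_contra fun h => hx ((hφ y hy).1.2.2 x h)
  obtain ⟨s, hs, hc, hxs⟩ := hK.exists_face_of_mem_space hxK
  refine ⟨_, ⟨s, hs, hc, rfl⟩, ?_, hxs⟩
  obtain ⟨w, hw0, hw, rfl⟩ := Finset.mem_convexHull'.1 hxs
  rw [hφ.apply_sum hy hs hc hw0 hw] at hx
  exact subset_convexHull ℝ _ (of_not_not fun h => hx (if_neg h))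

theorem IsHatFamily.apply_add_smul_sub (hφ : IsHatFamily K φ) (hy : y ∈ K.vertices)
    {k : Set (E d)} (hk : k ∈ elements K) (hyk : y ∈ k) {x : E d} (hxk : x ∈ k) {ε : ℝ}
    (hε : ε ∈ Icc 0 1) : φ y (y + ε • (x - y)) = 1 + ε * (φ y x - 1) := by
  obtain ⟨hP, h_one, -⟩ := hφ y hy
  obtain ⟨l, hl⟩ := hP.2.1 k hk
  have hx := affineMap_add l y (x - y)
  rw [add_sub_cancel, ← hl hxk, ← hl hyk, h_one] at hx
  rw [hl ((convex_of_mem_elements hk).add_smul_sub_mem hyk hxk hε), affineMap_add,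
    inner_smul_right, ← hl hyk, h_one, hx, add_sub_cancel_left]

theorem IsMesh.eventually_mem_element_imp (hK : IsMesh Ω ΓD ΓR Γt K) (y : E d) :
    ∀ᶠ z in 𝓝 y, ∀ k ∈ elements K, z ∈ k → y ∈ k := by
  refine (eventually_all_finite hK.finite_elements).2 fun k hk => ?_
  by_cases h : y ∈ k
  · exact Eventually.of_forall fun _ _ => h
  · filter_upwards [(isCompact_of_mem_elements hk).isClosed.isOpen_compl.mem_nhds h] with z hz hzk
    exact absurd hzk hz

theorem add_mem_convexHull_of_add_smul {V : Type*} [AddCommGroup V] [Module ℝ V] {s : Finset V}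
    {y v : V} (hy : y ∈ s) {ε : ℝ} (hε : 0 < ε) {w : V → ℝ} (hw0 : ∀ p ∈ s, 0 ≤ w p)
    (hw : ∑ p ∈ s, w p = 1) (hv : ∑ p ∈ s, w p • p = y + ε • v) (hwy : 1 - ε ≤ w y) :
    y + v ∈ convexHull ℝ (s : Set V) := by
  classical
  have h_erase : ∑ p ∈ s.erase y, w p = 1 - w y := by
    rw [← hw, ← Finset.add_sum_erase s w hy, add_sub_cancel_left]
  have h_erase_smul : ∑ p ∈ s.erase y, w p • p = y + ε • v - w y • y := by
    rw [← hv, ← Finset.add_sum_erase s _ hy, add_sub_cancel_left]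
  refine Finset.mem_convexHull'.2 ⟨fun p => if p = y then 1 - (1 - w y) / ε else w p / ε,
    fun p hp => ?_, ?_, ?_⟩
  · dsimp only
    split_ifs
    · exact sub_nonneg.2 (div_le_one_of_le₀ (by linarith) hε.le)
    · exact div_nonneg (hw0 p hp) hε.le
  · rw [← Finset.add_sum_erase s _ hy, if_pos rfl, Finset.sum_congr rfl (g := fun p => w p / ε)
      fun p hp => if_neg (Finset.ne_of_mem_erase hp), ← Finset.sum_div, h_erase, sub_add_cancel]
  · rw [← Finset.add_sum_erase s _ hy, Finset.sum_congr rfl (g := fun p => ε⁻¹ • (w p • p))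
      fun p hp => by simp only [if_neg (Finset.ne_of_mem_erase hp), smul_smul, div_eq_inv_mul],
      ← Finset.smul_sum, h_erase_smul]
    simp only [if_true]
    match_scalars <;> field

theorem IsMesh.add_mem_space_of_le_hat (hK : IsMesh Ω ΓD ΓR Γt K) (hφ : IsHatFamily K φ)
    (hy : y ∈ K.vertices) {v : E d} {ε : ℝ} (hε : 0 < ε) (h_mem : y + ε • v ∈ K.space)
    (h_star : ∀ k ∈ elements K, y + ε • v ∈ k → y ∈ k) (h_hat : 1 - ε ≤ φ y (y + ε • v)) :
    y + v ∈ K.space := by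
  classical
  obtain ⟨s, hs, hc, hvs⟩ := hK.exists_face_of_mem_space h_mem
  have hys : y ∈ s := (K.vertex_mem_convexHull_iff hy hs).1 (h_star _ ⟨s, hs, hc, rfl⟩ hvs)
  obtain ⟨w, hw0, hw, hwv⟩ := Finset.mem_convexHull'.1 hvs
  rw [← hwv, hφ.apply_sum hy hs hc hw0 hw, if_pos hys] at h_hat
  exact Geometry.SimplicialComplex.convexHull_subset_space hs
    (add_mem_convexHull_of_add_smul hys hε hw0 hw hwv h_hat)

-- Contract `x` towards `y` by a small factor `ε`: near `y` every point lies in the star of `y`,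
-- and the points `z` with `φ y z > 1 - ε` expand back into the star.
theorem IsMesh.mem_interior_of_hat_ne_zero (hK : IsMesh Ω ΓD ΓR Γt K) (hφ : IsHatFamily K φ)
    (hy : y ∈ K.vertices) (hyi : y ∈ interior K.space) {x : E d} (hx : φ y x ≠ 0) :
    x ∈ interior K.space := by
  obtain ⟨k, hk, hyk, hxk⟩ := hK.exists_element_of_hat_ne_zero hφ hy hx
  have h_pos : 0 < φ y x := (hK.hat_nonneg hφ hy x).lt_of_ne' hx
  have h_near : ∀ᶠ z in 𝓝 y, z ∈ interior K.space ∧ ∀ k ∈ elements K, z ∈ k → y ∈ k :=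
    (isOpen_interior.eventually_mem hyi).and (hK.eventually_mem_element_imp y)
  have h_contract : Tendsto (fun ε : ℝ => y + ε • (x - y)) (𝓝[>] 0) (𝓝 y) :=
    Continuous.tendsto' (by fun_prop) _ _ (by simp) |>.mono_left nhdsWithin_le_nhds
  obtain ⟨ε, hε_near, hε0, hε1⟩ := ((h_contract.eventually h_near.eventually_nhds).and
    (Ioc_mem_nhdsGT (zero_lt_one' ℝ))).exists
  have h_lt : ∀ᶠ z in 𝓝 (y + ε • (x - y)), 1 - ε < φ y z := by
    refine (((hφ y hy).1.1.mono interior_subset).continuousAt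
      (isOpen_interior.mem_nhds hε_near.self_of_nhds.1)).eventually (lt_mem_nhds ?_)
    rw [hφ.apply_add_smul_sub hy hk hyk hxk ⟨hε0.le, hε1⟩]
    nlinarith
  have h_expand : Tendsto (fun z => y + ε • (z - y)) (𝓝 x) (𝓝 (y + ε • (x - y))) :=
    Continuous.tendsto (by fun_prop) x
  rw [mem_interior_iff_mem_nhds]
  filter_upwards [h_expand.eventually (hε_near.and h_lt)] with z ⟨⟨hzi, hz_star⟩, hz_lt⟩
  simpa using hK.add_mem_space_of_le_hat hφ hy hε0 (interior_subset hzi) hz_star hz_lt.le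

theorem IsMesh.continuous_hat (hK : IsMesh Ω ΓD ΓR Γt K) (hφ : IsHatFamily K φ)
    (hy : y ∈ K.vertices) (hyi : y ∈ interior K.space) : Continuous (φ y) := by
  have h_closed : IsClosed K.space := hK.space_eq ▸ isClosed_closure
  have h_out : ContinuousOn (φ y) (interior K.space)ᶜ :=
    continuousOn_const.congr fun x hx =>
      of_not_not fun h => hx (hK.mem_interior_of_hat_ne_zero hφ hy hyi h)
  rw [← continuousOn_univ, ← union_compl_self (interior K.space)]
  exact ((hφ y hy).1.1.union_of_isClosed h_out h_closed isOpen_interior.isClosed_compl).mono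
    (union_subset_union_left _ interior_subset)

theorem lipschitzWith_of_finite_closed_cover {V : Type*} [NormedAddCommGroup V] [NormedSpace ℝ V]
    {f : V → ℝ} (hf : Continuous f) {𝒦 : Set (Set V)} (h_fin : 𝒦.Finite)
    (h_closed : ∀ k ∈ 𝒦, IsClosed k) (h_cover : ⋃₀ 𝒦 = univ) {C : ℝ≥0}
    (h_lip : ∀ k ∈ 𝒦, LipschitzOnWith C f k) : LipschitzWith C f := by
  refine LipschitzWith.of_le_add_mul C fun b a => ?_
  let γ : ℝ → V := AffineMap.lineMap a b
  have hγ : Continuous γ := AffineMap.lineMap_continuous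
  have h_slope : ∀ r ∈ Ico (0 : ℝ) 1, ∀ m, C * dist b a < m →
      ∃ᶠ ρ in 𝓝[>] r, slope (f ∘ γ) r ρ < m := by
    intro r _ m hm
    obtain ⟨k, hk, hrk, hfr⟩ := exists_mem_frequently_nhdsGT_of_finite_closed_cover h_fin h_closed
      hγ (Eventually.of_forall fun ρ => h_cover ▸ mem_univ (γ ρ)).frequently (r := r)
    refine (hfr.and_eventually self_mem_nhdsWithin).mono fun ρ ⟨hρk, (hρ : r < ρ)⟩ => ?_
    refine lt_of_le_of_lt ?_ hm
    rw [slope_def_field, div_le_iff₀ (sub_pos.2 hρ)]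
    calc f (γ ρ) - f (γ r) ≤ C * dist (γ ρ) (γ r) :=
          (le_abs_self _).trans ((h_lip k hk).dist_le_mul _ hρk _ hrk)
      _ = C * dist b a * (ρ - r) := by
          rw [dist_lineMap_lineMap, Real.dist_eq, abs_of_pos (sub_pos.2 hρ), dist_comm a b]
          ring
  have h_bound := image_le_of_liminf_slope_right_le_deriv_boundary (a := 0) (b := 1)
    (f := f ∘ γ) (B := fun r => f a + r * (C * dist b a)) (B' := fun _ => C * dist b a)
    (hf.comp hγ).continuousOn (by simp [γ]) (by fun_prop)
    (fun r _ => by simpa using ((hasDerivWithinAt_id r _).mul_const _).const_add (f a)) h_slope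
    (right_mem_Icc.2 zero_le_one)
  simpa [γ] using h_bound

theorem exists_lipschitzOnWith_element {w : E d → ℝ} (hw : w ∈ P1 K) {k : Set (E d)}
    (hk : k ∈ elements K) : ∃ C, LipschitzOnWith C w k := by
  obtain ⟨l, hl⟩ := hw.2.1 k hk
  refine ⟨‖affineGradient l‖₊, LipschitzOnWith.of_dist_le_mul fun a ha b hb => ?_⟩
  have hl_sub := affineMap_add l b (a - b)
  rw [add_sub_cancel] at hl_sub
  rw [hl ha, hl hb, hl_sub, Real.dist_eq, add_sub_cancel_left, dist_eq_norm]
  exact abs_real_inner_le_norm _ _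

theorem IsMesh.exists_lipschitzWith_hat (hK : IsMesh Ω ΓD ΓR Γt K) (hφ : IsHatFamily K φ)
    (hy : y ∈ K.vertices) (hyi : y ∈ interior K.space) : ∃ C, LipschitzWith C (φ y) := by
  choose! C hC using fun k (hk : k ∈ elements K) => exists_lipschitzOnWith_element (hφ y hy).1 hk
  obtain ⟨B, hB⟩ := (hK.finite_elements.image C).bddAbove
  have h_zero : ∀ x ∈ (interior K.space)ᶜ, φ y x = 0 := fun x hx =>
    of_not_not fun h => hx (hK.mem_interior_of_hat_ne_zero hφ hy hyi h)
  refine ⟨B, lipschitzWith_of_finite_closed_cover (hK.continuous_hat hφ hy hyi)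
    (hK.finite_elements.insert (interior K.space)ᶜ) ?_ ?_ ?_⟩
  · rintro k (rfl | hk)
    exacts [isOpen_interior.isClosed_compl, (isCompact_of_mem_elements hk).isClosed]
  · rw [sUnion_insert, ← hK.space_eq_sUnion, eq_univ_iff_forall]
    exact fun x => (em (x ∈ interior K.space)).elim (fun h => Or.inr (interior_subset h)) Or.inl
  · rintro k (rfl | hk)
    · refine LipschitzOnWith.of_dist_le_mul fun a ha b hb => ?_
      rw [h_zero a ha, h_zero b hb, dist_self]
      positivity
    · exact (hC k hk).weaken (hB ⟨k, hk, rfl⟩)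

end Hat

section Approximation

variable {V F : Type*} [NormedAddCommGroup V] [NormedSpace ℝ V] [FiniteDimensional ℝ V]
  [NormedAddCommGroup F] [NormedSpace ℝ F]

theorem exists_contDiff_hasCompactSupport_eventuallyEq {n : ℕ∞} {f : V → F} (hf : ContDiff ℝ n f)
    {S : Set V} (hS : Bornology.IsBounded S) :
    ∃ g : V → F, ContDiff ℝ n g ∧ HasCompactSupport g ∧ ∀ x ∈ S, g =ᶠ[𝓝 x] f := by
  obtain ⟨R, hR, hSR⟩ := hS.subset_ball_lt 0 0
  let χ : ContDiffBump (0 : V) := ⟨R, R + 1, hR, by linarith⟩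
  refine ⟨fun x => χ x • f x, χ.contDiff.smul hf, χ.hasCompactSupport.smul_right, fun x hx => ?_⟩
  filter_upwards [χ.eventuallyEq_one_of_mem_ball (hSR hx)] with z hz
  simp [hz]

theorem exists_contDiff_approx_of_hasCompactSupport [CompleteSpace F] {u : V → F}
    (hu : ContDiff ℝ 1 u) (hc : HasCompactSupport u) {ε : ℝ} (hε : 0 < ε) :
    ∃ v : V → F, ContDiff ℝ ((⊤ : ℕ∞) : WithTop ℕ∞) v ∧
      ∀ x, ‖v x - u x‖ ≤ ε ∧ ‖fderiv ℝ v x - fderiv ℝ u x‖ ≤ ε := by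
  borelize V
  let μ : Measure V := Measure.addHaar
  have h_cont : Continuous (fderiv ℝ u) := hu.continuous_fderiv one_ne_zero
  obtain ⟨δ₁, hδ₁, h₁⟩ := Metric.uniformContinuous_iff.1
    (hc.uniformContinuous_of_continuous hu.continuous) ε hε
  obtain ⟨δ₂, hδ₂, h₂⟩ := Metric.uniformContinuous_iff.1
    ((hc.fderiv ℝ).uniformContinuous_of_continuous h_cont) ε hε
  have hδ : 0 < min δ₁ δ₂ := lt_min hδ₁ hδ₂
  let χ : ContDiffBump (0 : V) := ⟨min δ₁ δ₂ / 2, min δ₁ δ₂, by positivity, by linarith⟩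
  have h_loc : LocallyIntegrable (χ.normed μ) μ := χ.continuous_normed.locallyIntegrable
  refine ⟨convolution (χ.normed μ) u (ContinuousLinearMap.lsmul ℝ ℝ) μ,
    χ.hasCompactSupport_normed.contDiff_convolution_left _ χ.contDiff_normed
      hu.continuous.locallyIntegrable, fun x => ⟨?_, ?_⟩⟩
  · rw [← dist_eq_norm]
    exact χ.dist_normed_convolution_le hu.continuous.aestronglyMeasurable
      fun z hz => (h₁ (lt_of_lt_of_le (Metric.mem_ball.1 hz) (min_le_left _ _))).le
  · rw [(hc.hasFDerivAt_convolution_right (ContinuousLinearMap.lsmul ℝ ℝ) h_loc hu x).fderiv,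
      ← dist_eq_norm]
    exact χ.dist_normed_convolution_le h_cont.aestronglyMeasurable
      fun z hz => (h₂ (lt_of_lt_of_le (Metric.mem_ball.1 hz) (min_le_right _ _))).le

theorem exists_contDiff_approx [CompleteSpace F] {u : V → F} (hu : ContDiff ℝ 1 u) {S : Set V}
    (hS : Bornology.IsBounded S) {ε : ℝ} (hε : 0 < ε) :
    ∃ v : V → F, ContDiff ℝ ((⊤ : ℕ∞) : WithTop ℕ∞) v ∧
      ∀ x ∈ S, ‖v x - u x‖ ≤ ε ∧ ‖fderiv ℝ v x - fderiv ℝ u x‖ ≤ ε := by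
  obtain ⟨u', hu', hc, h_eq⟩ := exists_contDiff_hasCompactSupport_eventuallyEq (n := 1) hu hS
  obtain ⟨v, hv, hvu⟩ := exists_contDiff_approx_of_hasCompactSupport hu' hc hε
  refine ⟨v, hv, fun x hx => ?_⟩
  rw [← (h_eq x hx).eq_of_nhds, ← (h_eq x hx).fderiv_eq]
  exact hvu x

end Approximation

section IntegrationByParts

theorem lineDeriv_eq_zero_of_notMem_tsupport {V : Type*} [NormedAddCommGroup V] [NormedSpace ℝ V]
    {η : V → ℝ} {x : V} (hx : x ∉ tsupport η) (v : V) : lineDeriv ℝ η x v = 0 := by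
  rw [(notMem_tsupport_iff_eventuallyEq.1 hx).lineDeriv_eq]
  simp [lineDeriv]

variable {V : Type*} [NormedAddCommGroup V] [NormedSpace ℝ V] [MeasurableSpace V] [BorelSpace V]
  {μ : Measure V} {C : ℝ≥0} {η : V → ℝ}

theorem integrable_lineDeriv_mul [IsFiniteMeasureOnCompacts μ] {f : V → ℝ}
    (hf : Continuous f) (hη : LipschitzWith C η) (hηc : HasCompactSupport η) (v : V) :
    Integrable (fun x => lineDeriv ℝ η x v * f x) μ := by
  have h_on : IntegrableOn (fun x => lineDeriv ℝ η x v * f x) (tsupport η) μ :=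
    (hf.continuousOn.integrableOn_compact hηc).bdd_mul
      (measurable_lineDeriv hη.continuous).aestronglyMeasurable
      (Eventually.of_forall fun x => norm_lineDeriv_le_of_lipschitz ℝ hη)
  refine h_on.integrable_of_forall_notMem_eq_zero fun x hx => ?_
  rw [lineDeriv_eq_zero_of_notMem_tsupport hx, zero_mul]

theorem integral_lineDeriv_mul_eq_neg_integral_fderiv_mul [FiniteDimensional ℝ V]
    [μ.IsAddHaarMeasure] {f : V → ℝ} (hf : ContDiff ℝ 1 f) (hη : LipschitzWith C η)
    (hηc : HasCompactSupport η) (v : V) :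
    ∫ x, lineDeriv ℝ η x v * f x ∂μ = -∫ x, fderiv ℝ f x v * η x ∂μ := by
  obtain ⟨g, hg, hgc, h_eq⟩ :=
    exists_contDiff_hasCompactSupport_eventuallyEq (n := 1) hf hηc.isCompact.isBounded
  obtain ⟨C', hgL⟩ := hg.lipschitzWith_of_hasCompactSupport hgc one_ne_zero
  calc ∫ x, lineDeriv ℝ η x v * f x ∂μ
      = ∫ x, lineDeriv ℝ η x v * g x ∂μ := by
        congr 1 with x
        by_cases hx : x ∈ tsupport η
        · rw [(h_eq x hx).eq_of_nhds]
        · simp only [lineDeriv_eq_zero_of_notMem_tsupport hx, zero_mul]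
    _ = ∫ x, lineDeriv ℝ g x (-v) * η x ∂μ := hη.integral_lineDeriv_mul_eq hgL hgc v
    _ = ∫ x, -(fderiv ℝ f x v * η x) ∂μ := by
        congr 1 with x
        by_cases hx : x ∈ tsupport η
        · rw [(hg.differentiable one_ne_zero x).lineDeriv_eq_fderiv, (h_eq x hx).fderiv_eq,
            map_neg, neg_mul]
        · simp only [image_eq_zero_of_notMem_tsupport hx, mul_zero, neg_zero]
    _ = -∫ x, fderiv ℝ f x v * η x ∂μ := integral_neg _

end IntegrationByParts

section Green

variable {V : Type*} [NormedAddCommGroup V] [InnerProductSpace ℝ V] [FiniteDimensional ℝ V]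

theorem laplacian_eq_sum_fderiv {ι : Type*} [Fintype ι] (e : OrthonormalBasis ι ℝ V) (w : V → ℝ)
    (x : V) : Laplacian.laplacian w x = ∑ j, fderiv ℝ (fderiv ℝ w) x (e j) (e j) := by
  rw [InnerProductSpace.laplacian_eq_iteratedFDeriv_orthonormalBasis w e]
  simp [iteratedFDeriv_two_apply]

theorem continuous_laplacian {w : V → ℝ} (hw : ContDiff ℝ 2 w) :
    Continuous (Laplacian.laplacian w) := by
  have h_hess : Continuous (fderiv ℝ (fderiv ℝ w)) :=
    (hw.fderiv_right (m := 1) le_rfl).continuous_fderiv one_ne_zero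
  simp only [funext (laplacian_eq_sum_fderiv (stdOrthonormalBasis ℝ V) w)]
  exact continuous_finsetSum _ fun j _ =>
    (h_hess.clm_apply continuous_const).clm_apply continuous_const

theorem integral_inner_gradient_gradient [MeasurableSpace V] [BorelSpace V] {μ : Measure V}
    [μ.IsAddHaarMeasure] {w η : V → ℝ} (hw : ContDiff ℝ 2 w) {C : ℝ≥0} (hη : LipschitzWith C η)
    (hηc : HasCompactSupport η) :
    ∫ x, inner ℝ (gradient w x) (gradient η x) ∂μ = -∫ x, Laplacian.laplacian w x * η x ∂μ := by
  let e := stdOrthonormalBasis ℝ V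
  have hw' : ContDiff ℝ 1 (fderiv ℝ w) := hw.fderiv_right (by norm_num)
  have h_comp : ∀ j, ContDiff ℝ 1 fun x => fderiv ℝ w x (e j) := fun j =>
    hw'.clm_apply contDiff_const
  have h_second : ∀ j x, fderiv ℝ (fun x => fderiv ℝ w x (e j)) x (e j)
      = fderiv ℝ (fderiv ℝ w) x (e j) (e j) := fun j x => by
    rw [fderiv_clm_apply (hw'.differentiable one_ne_zero x) (differentiableAt_const _)]
    simp
  have h_int : ∀ j, Integrable (fun x => fderiv ℝ (fderiv ℝ w) x (e j) (e j) * η x) μ := fun j =>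
    ((((hw'.continuous_fderiv one_ne_zero).clm_apply continuous_const).clm_apply
      continuous_const).mul hη.continuous).integrable_of_hasCompactSupport hηc.mul_left
  calc ∫ x, inner ℝ (gradient w x) (gradient η x) ∂μ
      = ∫ x, ∑ j, lineDeriv ℝ η x (e j) * fderiv ℝ w x (e j) ∂μ := by
        refine integral_congr_ae ?_
        filter_upwards [hη.ae_differentiableAt] with x hx
        rw [← e.sum_inner_mul_inner]
        refine Finset.sum_congr rfl fun j _ => ?_
        rw [hx.lineDeriv_eq_fderiv, inner_gradient_left, real_inner_comm, inner_gradient_left,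
          mul_comm]
    _ = ∑ j, ∫ x, lineDeriv ℝ η x (e j) * fderiv ℝ w x (e j) ∂μ :=
        integral_finsetSum _ fun j _ =>
          integrable_lineDeriv_mul (h_comp j).continuous hη hηc (e j)
    _ = ∑ j, -∫ x, fderiv ℝ (fderiv ℝ w) x (e j) (e j) * η x ∂μ := by
        simp only [integral_lineDeriv_mul_eq_neg_integral_fderiv_mul (h_comp _) hη hηc, h_second]
    _ = -∫ x, Laplacian.laplacian w x * η x ∂μ := by
        rw [Finset.sum_neg_distrib, ← integral_finsetSum _ fun j _ => h_int j]
        simp only [laplacian_eq_sum_fderiv e, Finset.sum_mul]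

end Green

section W1inf

variable {d : ℕ} {Ω : Set (E d)} {u v w : E d → ℝ}

theorem gradient_add {x : E d} (hu : DifferentiableAt ℝ u x) (hv : DifferentiableAt ℝ v x) :
    gradient (u + v) x = gradient u x + gradient v x := by
  rw [gradient, fderiv_add hu hv, map_add, gradient, gradient]

theorem gradient_sub {x : E d} (hu : DifferentiableAt ℝ u x) (hv : DifferentiableAt ℝ v x) :
    gradient (u - v) x = gradient u x - gradient v x := by
  rw [gradient, fderiv_sub hu hv, map_sub, gradient, gradient]

theorem norm_gradient_sub (u v : E d → ℝ) (x : E d) :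
    ‖gradient u x - gradient v x‖ = ‖fderiv ℝ u x - fderiv ℝ v x‖ := by
  rw [gradient, gradient, ← map_sub, LinearIsometryEquiv.norm_map]

theorem W1inf_add_le (hu : ∀ᵐ x ∂volume.restrict Ω, DifferentiableAt ℝ u x)
    (hv : ∀ᵐ x ∂volume.restrict Ω, DifferentiableAt ℝ v x) :
    W1inf Ω (u + v) ≤ W1inf Ω u + W1inf Ω v := by
  have h_grad : gradient (u + v) =ᵐ[volume.restrict Ω] gradient u + gradient v := by
    filter_upwards [hu, hv] with x hux hvx using gradient_add hux hvx
  simp only [W1inf, eLpNorm_congr_ae h_grad, eLpNorm_exponent_top]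
  exact (add_le_add eLpNormEssSup_add_le eLpNormEssSup_add_le).trans
    (add_add_add_comm _ _ _ _).le

theorem W1inf_neg (w : E d → ℝ) : W1inf Ω (-w) = W1inf Ω w := by
  have h_grad : gradient (-w) = -gradient w := by
    ext1 x
    rw [Pi.neg_apply, gradient, fderiv_neg, map_neg, gradient]
  rw [W1inf, h_grad, eLpNorm_neg, eLpNorm_neg, W1inf]

theorem W1inf_sub_comm (u v : E d → ℝ) : W1inf Ω (u - v) = W1inf Ω (v - u) := by
  rw [← neg_sub, W1inf_neg]

theorem W1inf_sub_le (hΩ : MeasurableSet Ω) (hu : Differentiable ℝ u) (hv : Differentiable ℝ v)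
    {c : ℝ} (h : ∀ x ∈ Ω, ‖u x - v x‖ ≤ c) (h' : ∀ x ∈ Ω, ‖fderiv ℝ u x - fderiv ℝ v x‖ ≤ c) :
    W1inf Ω (u - v) ≤ 2 * ENNReal.ofReal c := by
  rw [W1inf, two_mul, eLpNorm_exponent_top, eLpNorm_exponent_top]
  refine add_le_add (eLpNormEssSup_le_of_ae_bound ?_) (eLpNormEssSup_le_of_ae_bound ?_) <;>
    filter_upwards [ae_restrict_mem hΩ] with x hx
  · exact h x hx
  · rw [gradient_sub (hu x) (hv x), norm_gradient_sub]
    exact h' x hx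

theorem ae_norm_le_of_W1inf_le {c : ℝ} (hc : 0 ≤ c) (h : W1inf Ω w ≤ ENNReal.ofReal c) :
    ∀ᵐ x ∂volume.restrict Ω, ‖w x‖ ≤ c ∧ ‖gradient w x‖ ≤ c := by
  rw [W1inf, eLpNorm_exponent_top, eLpNorm_exponent_top] at h
  filter_upwards [enorm_ae_le_eLpNormEssSup w (volume.restrict Ω),
    enorm_ae_le_eLpNormEssSup (gradient w) (volume.restrict Ω)] with x hw hgw
  rw [← ENNReal.ofReal_le_ofReal_iff hc, ← ENNReal.ofReal_le_ofReal_iff hc, ofReal_norm,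
    ofReal_norm]
  exact ⟨(hw.trans le_self_add).trans h, (hgw.trans le_add_self).trans h⟩

theorem exists_pos_two_mul_ofReal_le {ε : ℝ≥0∞} (hε : 0 < ε) :
    ∃ c : ℝ, 0 < c ∧ 2 * ENNReal.ofReal c ≤ ε := by
  obtain ⟨r, hr, hrε⟩ := ENNReal.lt_iff_exists_nnreal_btwn.1 hε
  refine ⟨r / 2, half_pos (by exact_mod_cast hr), ?_⟩
  rw [← ENNReal.ofReal_ofNat, ← ENNReal.ofReal_mul zero_le_two, mul_div_cancel₀ _ two_ne_zero,
    ENNReal.ofReal_coe_nnreal]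
  exact hrε.le

theorem tendsto_W1inf_sub {w : ℕ → E d → ℝ} (hΩ : MeasurableSet Ω)
    (hw : ∀ i, Differentiable ℝ (w i)) (hu : Differentiable ℝ u)
    (h : TendstoUniformlyOn w u atTop Ω)
    (h' : TendstoUniformlyOn (fun i => fderiv ℝ (w i)) (fderiv ℝ u) atTop Ω) :
    Tendsto (fun i => W1inf Ω (w i - u)) atTop (𝓝 0) := by
  rw [ENNReal.tendsto_nhds_zero]
  intro ε hε
  obtain ⟨c, hc, hcε⟩ := exists_pos_two_mul_ofReal_le hε
  filter_upwards [Metric.tendstoUniformlyOn_iff.1 h c hc,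
    Metric.tendstoUniformlyOn_iff.1 h' c hc] with i hi hi'
  rw [W1inf_sub_comm]
  refine (W1inf_sub_le hΩ hu (hw i) (fun x hx => ?_) fun x hx => ?_).trans hcε
  · exact (dist_eq_norm _ _).symm.trans_le (hi x hx).le
  · exact (dist_eq_norm _ _).symm.trans_le (hi' x hx).le

theorem exists_contDiff_W1inf_sub_le (hΩ : MeasurableSet Ω) (hb : Bornology.IsBounded Ω)
    (hu : ContDiff ℝ 1 u) {ε : ℝ≥0∞} (hε : 0 < ε) :
    ∃ v : E d → ℝ, ContDiff ℝ ((⊤ : ℕ∞) : WithTop ℕ∞) v ∧ W1inf Ω (v - u) ≤ ε := by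
  obtain ⟨c, hc, hcε⟩ := exists_pos_two_mul_ofReal_le hε
  obtain ⟨v, hv, hvu⟩ := exists_contDiff_approx hu hb hc
  exact ⟨v, hv, (W1inf_sub_le hΩ (hv.differentiable (by simp)) (hu.differentiable one_ne_zero)
    (fun x hx => (hvu x hx).1) fun x hx => (hvu x hx).2).trans hcε⟩

end W1inf

section OpenSet

variable {X : Type*} [TopologicalSpace X] [MeasurableSpace X] [OpensMeasurableSpace X]
  {μ : Measure X} [μ.IsOpenPosMeasure] {U : Set X}

theorem dense_imp_of_ae_restrict {p : X → Prop} (hU : IsOpen U) (h : ∀ᵐ x ∂μ.restrict U, p x) :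
    Dense {x | x ∈ U → p x} :=
  Measure.dense_of_ae ((ae_restrict_iff' hU.measurableSet).1 h)

theorem le_on_closure_of_ae_restrict (hU : IsOpen U) {f : X → ℝ} {c : ℝ}
    (hf : ContinuousOn f (closure U)) (h : ∀ᵐ x ∂μ.restrict U, f x ≤ c) {x : X}
    (hx : x ∈ closure U) : f x ≤ c := by
  have h_cl : closure U ⊆ closure (U ∩ {x | x ∈ U → f x ≤ c}) :=
    closure_minimal ((dense_imp_of_ae_restrict hU h).open_subset_closure_inter hU) isClosed_closure
  exact le_on_closure (fun z hz => hz.2 hz.1)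
    (hf.mono (closure_mono inter_subset_left)) continuousOn_const (h_cl hx)

end OpenSet

section Projection

variable {d : ℕ} {A : Type*} [MetricSpace A] {pb : Problem d A} {D : Scheme pb}

theorem contDiff_of_C2 (w : C2 d) : ContDiff ℝ 2 (w : E d → ℝ) := w.2

theorem differentiable_of_C2 (w : C2 d) : Differentiable ℝ (w : E d → ℝ) :=
  (contDiff_of_C2 w).differentiable two_ne_zero

theorem Scheme.ae_differentiableAt (D : Scheme pb) {i : ℕ} {w : E d → ℝ} (hw : w ∈ D.V i) :
    ∀ᵐ x ∂volume.restrict pb.Ω, DifferentiableAt ℝ w x :=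
  ae_restrict_of_ae_restrict_of_subset subset_closure ((D.isMesh i).ae_differentiableAt hw)

theorem Scheme.continuousOn_closure (D : Scheme pb) {i : ℕ} {w : E d → ℝ} (hw : w ∈ D.V i) :
    ContinuousOn w (closure pb.Ω) :=
  (D.isMesh i).space_eq ▸ hw.1

theorem EllipticProjection.exists_W1inf_le (Q : EllipticProjection D) :
    ∃ C : ℝ≥0, ∀ i (w : C2 d),
      W1inf pb.Ω (Q.P i w : E d → ℝ) ≤ C * W1inf pb.Ω (w : E d → ℝ) := by
  obtain ⟨C, hC⟩ := Q.stable
  refine ⟨C, fun i w => ?_⟩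
  obtain ⟨B, hB⟩ := Q.continuous i
  have h_bound : ∀ δ : ℝ≥0∞, 0 < δ → W1inf pb.Ω (Q.P i w : E d → ℝ) ≤
      B * δ + C * (δ + W1inf pb.Ω (w : E d → ℝ)) := by
    intro δ hδ
    obtain ⟨v, hv, hvw⟩ := exists_contDiff_W1inf_sub_le pb.domain.isOpen.measurableSet
      pb.domain.isBounded ((contDiff_of_C2 w).of_le one_le_two) hδ
    let v' : C2 d := ⟨v, contDiff_infty.1 hv 2⟩
    calc W1inf pb.Ω (Q.P i w : E d → ℝ)
        = W1inf pb.Ω ((Q.P i (w - v') : E d → ℝ) + (Q.P i v' : E d → ℝ)) := by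
          rw [← Submodule.coe_add, ← map_add, sub_add_cancel]
      _ ≤ W1inf pb.Ω (Q.P i (w - v') : E d → ℝ) + W1inf pb.Ω (Q.P i v' : E d → ℝ) :=
          W1inf_add_le (D.ae_differentiableAt (Q.P i _).2) (D.ae_differentiableAt (Q.P i _).2)
      _ ≤ B * δ + C * W1inf pb.Ω (v - w + w) := by
          refine add_le_add ((hB _).trans (mul_le_mul_right (le_of_eq_of_le ?_ hvw) _))
            ((hC i v' hv).trans_eq ?_)
          · exact W1inf_sub_comm _ _
          · rw [sub_add_cancel]
      _ ≤ B * δ + C * (δ + W1inf pb.Ω (w : E d → ℝ)) := by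
          gcongr
          refine (W1inf_add_le ?_ ?_).trans (add_le_add_left hvw _)
          · exact .of_forall fun x =>
              ((hv.differentiable (by simp)).sub (differentiable_of_C2 w)) x
          · exact .of_forall (differentiable_of_C2 w)
  have h_lim : Tendsto (fun δ : ℝ≥0∞ => B * δ + C * (δ + W1inf pb.Ω (w : E d → ℝ))) (𝓝[>] 0)
      (𝓝 (B * 0 + C * (0 + W1inf pb.Ω (w : E d → ℝ)))) := by
    refine (Continuous.tendsto ?_ 0).mono_left nhdsWithin_le_nhds
    fun_prop (disch := simp)
  rw [mul_zero, zero_add, zero_add] at h_lim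
  exact ge_of_tendsto h_lim (eventually_mem_nhdsWithin.mono h_bound)

theorem EllipticProjection.W1inf_sub_le (Q : EllipticProjection D) {C : ℝ≥0}
    (hC : ∀ i (w : C2 d), W1inf pb.Ω (Q.P i w : E d → ℝ) ≤ C * W1inf pb.Ω (w : E d → ℝ))
    {u : E d → ℝ} (hu : Differentiable ℝ u) (v w : C2 d) (i : ℕ) :
    W1inf pb.Ω ((Q.P i w : E d → ℝ) - u) ≤
      C * (W1inf pb.Ω ((w : E d → ℝ) - u) + W1inf pb.Ω ((v : E d → ℝ) - u)) +
        (W1inf pb.Ω ((Q.P i v : E d → ℝ) - (v : E d → ℝ)) + W1inf pb.Ω ((v : E d → ℝ) - u)) := by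
  have hv := differentiable_of_C2 v
  have hPv : ∀ᵐ x ∂volume.restrict pb.Ω,
      DifferentiableAt ℝ ((Q.P i v : E d → ℝ) - (v : E d → ℝ)) x :=
    (D.ae_differentiableAt (Q.P i v).2).mono fun x hx => hx.sub (hv x)
  have h_split : (Q.P i w : E d → ℝ) - u = (Q.P i (w - v) : E d → ℝ) +
      (((Q.P i v : E d → ℝ) - (v : E d → ℝ)) + ((v : E d → ℝ) - u)) := by
    rw [map_sub, Submodule.coe_sub]
    abel
  have h_diff : W1inf pb.Ω ((w - v : C2 d) : E d → ℝ) ≤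
      W1inf pb.Ω ((w : E d → ℝ) - u) + W1inf pb.Ω ((v : E d → ℝ) - u) := by
    rw [Submodule.coe_sub, ← sub_add_sub_cancel _ u, W1inf_sub_comm (v : E d → ℝ) u]
    exact W1inf_add_le (.of_forall ((differentiable_of_C2 w).sub hu)) (.of_forall (hu.sub hv))
  rw [h_split]
  exact (W1inf_add_le (D.ae_differentiableAt (Q.P i _).2)
    (hPv.mono fun x hx => hx.add ((hv.sub hu) x))).trans
    (add_le_add ((hC i _).trans (mul_le_mul_right h_diff _))
      (W1inf_add_le hPv (.of_forall (hv.sub hu))))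

theorem EllipticProjection.tendsto_W1inf_sub (Q : EllipticProjection D) {w : ℕ → C2 d}
    {u : E d → ℝ} (hu : ContDiff ℝ 1 u)
    (hw : Tendsto (fun i => W1inf pb.Ω ((w i : E d → ℝ) - u)) atTop (𝓝 0)) :
    Tendsto (fun i => W1inf pb.Ω ((Q.P i (w i) : E d → ℝ) - u)) atTop (𝓝 0) := by
  obtain ⟨C, hC⟩ := Q.exists_W1inf_le
  rw [ENNReal.tendsto_nhds_zero]
  intro ε hε
  have h_lim : Tendsto (fun δ : ℝ≥0∞ => C * (0 + δ) + (0 + δ)) (𝓝[>] 0) (𝓝 0) := by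
    have h_cont : Continuous fun δ : ℝ≥0∞ => C * (0 + δ) + (0 + δ) := by fun_prop (disch := simp)
    simpa using (h_cont.tendsto 0).mono_left nhdsWithin_le_nhds
  obtain ⟨δ, hδε, hδ⟩ := ((h_lim.eventually (gt_mem_nhds hε)).and self_mem_nhdsWithin).exists
  obtain ⟨v, hv, hvu⟩ :=
    exists_contDiff_W1inf_sub_le pb.domain.isOpen.measurableSet pb.domain.isBounded hu hδ
  let v' : C2 d := ⟨v, contDiff_infty.1 hv 2⟩
  have h_bound : Tendsto (fun i => C * (W1inf pb.Ω ((w i : E d → ℝ) - u) + W1inf pb.Ω (v - u)) +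
      (W1inf pb.Ω ((Q.P i v' : E d → ℝ) - v) + W1inf pb.Ω (v - u))) atTop
      (𝓝 (C * (0 + W1inf pb.Ω (v - u)) + (0 + W1inf pb.Ω (v - u)))) :=
    (ENNReal.Tendsto.const_mul (hw.add_const _) (Or.inr ENNReal.coe_ne_top)).add
      ((Q.tendsto v' hv).add_const _)
  have h_limit_lt : C * (0 + W1inf pb.Ω (v - u)) + (0 + W1inf pb.Ω (v - u)) < ε :=
    lt_of_le_of_lt (by gcongr) hδε
  filter_upwards [h_bound.eventually (gt_mem_nhds h_limit_lt)] with i hi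
  exact (Q.W1inf_sub_le hC (hu.differentiable one_ne_zero) v' (w i) i).trans hi.le

theorem Scheme.abs_sub_le_of_W1inf_le (D : Scheme pb) {i : ℕ} {p u : E d → ℝ} (hp : p ∈ D.V i)
    (hu : Continuous u) {ε : ℝ} (hε : 0 ≤ ε) (h : W1inf pb.Ω (p - u) ≤ ENNReal.ofReal ε) {x : E d}
    (hx : x ∈ closure pb.Ω) : |p x - u x| ≤ ε := by
  have h_cont : ContinuousOn (fun z => |p z - u z|) (closure pb.Ω) :=
    ((D.continuousOn_closure hp).sub hu.continuousOn).abs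
  exact le_on_closure_of_ae_restrict (μ := volume) pb.domain.isOpen h_cont
    ((ae_norm_le_of_W1inf_le hε h).mono fun z hz => hz.1) hx

theorem Scheme.ae_norm_gradient_sub_le (D : Scheme pb) {i : ℕ} {p u : E d → ℝ} (hp : p ∈ D.V i)
    (hu : Differentiable ℝ u) {ε : ℝ} (hε : 0 ≤ ε)
    (h : W1inf pb.Ω (p - u) ≤ ENNReal.ofReal ε) :
    ∀ᵐ x ∂volume.restrict pb.Ω, ‖gradient p x - gradient u x‖ ≤ ε := by
  filter_upwards [ae_norm_le_of_W1inf_le hε h, D.ae_differentiableAt hp] with x hx hpx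
  rw [← gradient_sub hpx (hu x)]
  exact hx.2

end Projection

section Slices

variable {X V : Type*} [NormedAddCommGroup V]

theorem tendstoUniformlyOn_slice [TopologicalSpace X] {G : ℝ × X → V} (hG : Continuous G)
    {S : Set X} (hS : IsCompact S) (t : ℝ) :
    TendstoUniformlyOn (fun s z => G (s, z)) (fun z => G (t, z)) (𝓝 t) S := by
  refine Metric.tendstoUniformlyOn_iff.2 fun ε hε =>
    hS.eventually_forall_of_forall_eventually fun z _ => ?_
  have h_cont : Continuous fun p : ℝ × X => dist (G (t, p.2)) (G (p.1, p.2)) := by fun_prop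
  exact h_cont.tendsto' (t, z) 0 (dist_self _) (gt_mem_nhds hε)

variable [NormedSpace ℝ V]

theorem norm_inv_smul_sub_sub_le {g g' : ℝ → V} {s h ε : ℝ} {m : V} (hh : 0 < h)
    (hg : ∀ σ, HasDerivAt g (g' σ) σ) (hm : ∀ σ ∈ Icc s (s + h), ‖g' σ - m‖ ≤ ε) :
    ‖h⁻¹ • (g (s + h) - g s) - m‖ ≤ ε := by
  have h_deriv : ∀ σ ∈ Icc s (s + h),
      HasDerivWithinAt (fun σ => g σ - σ • m) (g' σ - m) (Icc s (s + h)) σ := by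
    intro σ _
    simpa only [id, one_smul] using
      ((hg σ).fun_sub ((hasDerivAt_id σ).smul_const m)).hasDerivWithinAt
  have h_mvt := (convex_Icc s (s + h)).norm_image_sub_le_of_norm_hasDerivWithin_le h_deriv hm
    (left_mem_Icc.2 (by linarith)) (right_mem_Icc.2 (by linarith))
  have h_eq : g (s + h) - (s + h) • m - (g s - s • m) = h • (h⁻¹ • (g (s + h) - g s) - m) := by
    rw [smul_sub, smul_inv_smul₀ hh.ne', add_smul]
    abel
  rw [h_eq, norm_smul, add_sub_cancel_left, mul_comm] at h_mvt
  exact le_of_mul_le_mul_right h_mvt (norm_pos_iff.2 hh.ne')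

theorem tendstoUniformlyOn_inv_smul_sub [TopologicalSpace X] {G G' : ℝ × X → V}
    (hG : ∀ s x, HasDerivAt (fun σ => G (σ, x)) (G' (s, x)) s) (hG' : Continuous G')
    {S : Set X} (hS : IsCompact S) {t : ℝ} {s h : ℕ → ℝ} (hs : Tendsto s atTop (𝓝 t))
    (h_pos : ∀ i, 0 < h i) (hh : Tendsto h atTop (𝓝 0)) :
    TendstoUniformlyOn (fun i z => (h i)⁻¹ • (G (s i + h i, z) - G (s i, z)))
      (fun z => G' (t, z)) atTop S := by
  refine Metric.tendstoUniformlyOn_iff.2 fun ε hε => ?_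
  have h_near := (Metric.tendstoUniformlyOn_iff.1 (tendstoUniformlyOn_slice hG' hS t) (ε / 2)
    (half_pos hε)).smallSets
  have hsh : Tendsto (fun i => s i + h i) atTop (𝓝 t) := by simpa using hs.add hh
  filter_upwards [(hs.Icc hsh).eventually h_near] with i hi z hz
  rw [dist_comm, dist_eq_norm]
  refine (norm_inv_smul_sub_sub_le (h_pos i) (fun σ => hG σ z) fun σ hσ => ?_).trans_lt
    (half_lt_self hε)
  rw [← dist_eq_norm, dist_comm]
  exact (hi σ hσ z hz).le

variable [NormedAddCommGroup X] [NormedSpace ℝ X] {ψ : ℝ × X → V}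

theorem fderiv_slice {s : ℝ} {x : X} (hψ : DifferentiableAt ℝ ψ (s, x)) :
    fderiv ℝ (fun z => ψ (s, z)) x = (fderiv ℝ ψ (s, x)).comp (.inr ℝ ℝ X) :=
  (hψ.hasFDerivAt.comp x (hasFDerivAt_prodMk_right s x)).fderiv

theorem hasDerivAt_slice {s : ℝ} {x : X} (hψ : DifferentiableAt ℝ ψ (s, x)) :
    HasDerivAt (fun σ => ψ (σ, x)) (fderiv ℝ ψ (s, x) (1, 0)) s :=
  hψ.hasFDerivAt.comp_hasDerivAt s ((hasDerivAt_id s).prodMk (hasDerivAt_const s x))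

theorem contDiff_deriv_slice (hψ : ContDiff ℝ 2 ψ) (t : ℝ) :
    ContDiff ℝ 1 fun x => deriv (fun s => ψ (s, x)) t := by
  simp only [(hasDerivAt_slice (hψ.differentiable two_ne_zero (t, _))).deriv]
  exact ((hψ.fderiv_right le_rfl).comp (contDiff_prodMk_right t)).clm_apply contDiff_const

theorem hasDerivAt_fderiv_slice (hψ : ContDiff ℝ 2 ψ) (s : ℝ) (x : X) :
    HasDerivAt (fun σ => fderiv ℝ (fun z => ψ (σ, z)) x)
      ((fderiv ℝ (fderiv ℝ ψ) (s, x) (1, 0)).comp (.inr ℝ ℝ X)) s := by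
  have hψ' : Differentiable ℝ (fderiv ℝ ψ) :=
    (hψ.fderiv_right (m := 1) le_rfl).differentiable one_ne_zero
  simp only [fderiv_slice (hψ.differentiable two_ne_zero (_, x))]
  simpa only [ContinuousLinearMap.comp_zero, add_zero] using
    (hasDerivAt_slice (hψ' (s, x))).clm_comp (hasDerivAt_const s (.inr ℝ ℝ X))

theorem fderiv_deriv_slice (hψ : ContDiff ℝ 2 ψ) (t : ℝ) (x : X) :
    fderiv ℝ (fun z => deriv (fun s => ψ (s, z)) t) x =
      (fderiv ℝ (fderiv ℝ ψ) (t, x) (1, 0)).comp (.inr ℝ ℝ X) := by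
  have hψ' : Differentiable ℝ (fderiv ℝ ψ) :=
    (hψ.fderiv_right (m := 1) le_rfl).differentiable one_ne_zero
  have h_symm : IsSymmSndFDerivAt ℝ ψ (t, x) := hψ.contDiffAt.isSymmSndFDerivAt (by simp)
  simp only [(hasDerivAt_slice (hψ.differentiable two_ne_zero (t, _))).deriv]
  ext v
  rw [fderiv_clm_apply (by fun_prop) (by fun_prop), fderiv_slice (hψ' (t, x))]
  simpa using h_symm.eq (0, v) (1, 0)

theorem iteratedFDeriv_two_slice (hψ : ContDiff ℝ 2 ψ) (s : ℝ) (x v : X) :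
    iteratedFDeriv ℝ 2 (fun z => ψ (s, z)) x ![v, v] =
      iteratedFDeriv ℝ 2 ψ (s, x) ![(0, v), (0, v)] := by
  have h_shift : ContDiff ℝ 2 fun p : ℝ × X => ψ (p + (s, 0)) := by fun_prop
  have h_eq : (fun z => ψ (s, z)) = (fun p : ℝ × X => ψ (p + (s, 0))) ∘
      ContinuousLinearMap.inr ℝ ℝ X := by
    ext z
    simp
  rw [h_eq, ContinuousLinearMap.iteratedFDeriv_comp_right _ h_shift x le_rfl,
    iteratedFDeriv_comp_add_right, ContinuousMultilinearMap.compContinuousLinearMap_apply]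
  congr 1
  · simp
  · ext j : 1
    fin_cases j <;> rfl

end Slices

section W1infSlices

variable {d : ℕ} {ψ : ℝ × E d → ℝ} {Ω : Set (E d)} {t : ℝ} {s h : ℕ → ℝ}

theorem continuous_laplacian_slice (hψ : ContDiff ℝ 2 ψ) :
    Continuous fun p : ℝ × E d => Laplacian.laplacian (fun z => ψ (p.1, z)) p.2 := by
  simp only [InnerProductSpace.laplacian_eq_iteratedFDeriv_stdOrthonormalBasis,
    iteratedFDeriv_two_slice hψ]
  have := hψ.continuous_iteratedFDeriv le_rfl
  fun_prop

theorem tendsto_W1inf_slice_sub (hψ : ContDiff ℝ 2 ψ) (hΩ : MeasurableSet Ω)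
    (hb : Bornology.IsBounded Ω) (hs : Tendsto s atTop (𝓝 t)) :
    Tendsto (fun i => W1inf Ω ((slice ψ hψ (s i) : E d → ℝ) - fun x => ψ (t, x)))
      atTop (𝓝 0) := by
  have hψ' : Continuous fun p : ℝ × E d => fderiv ℝ (fun z => ψ (p.1, z)) p.2 := by
    simp only [fderiv_slice (hψ.differentiable two_ne_zero _)]
    exact (hψ.continuous_fderiv two_ne_zero).clm_comp continuous_const
  refine tendsto_W1inf_sub hΩ (fun i => differentiable_of_C2 _)
    (differentiable_of_C2 (slice ψ hψ t)) (fun v hv => ?_) fun v hv => ?_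
  · exact hs.eventually (((tendstoUniformlyOn_slice hψ.continuous hb.isCompact_closure t).mono
      subset_closure) v hv)
  · exact hs.eventually (((tendstoUniformlyOn_slice hψ' hb.isCompact_closure t).mono
      subset_closure) v hv)

theorem tendsto_W1inf_inv_smul_slice_sub (hψ : ContDiff ℝ 2 ψ) (hΩ : MeasurableSet Ω)
    (hb : Bornology.IsBounded Ω) (hs : Tendsto s atTop (𝓝 t)) (h_pos : ∀ i, 0 < h i)
    (hh : Tendsto h atTop (𝓝 0)) :
    Tendsto (fun i => W1inf Ω
      ((((h i)⁻¹ • (slice ψ hψ (s i + h i) - slice ψ hψ (s i)) : C2 d) : E d → ℝ) -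
        fun x => deriv (fun σ => ψ (σ, x)) t)) atTop (𝓝 0) := by
  have hψ_diff : Differentiable ℝ ψ := hψ.differentiable two_ne_zero
  have hψ'_cont : Continuous fun p => fderiv ℝ ψ p (1, 0) :=
    (hψ.continuous_fderiv two_ne_zero).clm_apply continuous_const
  have hψ''_cont : Continuous fun p : ℝ × E d =>
      (fderiv ℝ (fderiv ℝ ψ) p (1, 0)).comp (ContinuousLinearMap.inr ℝ ℝ (E d)) :=
    (((hψ.fderiv_right le_rfl).continuous_fderiv one_ne_zero).clm_apply
      continuous_const).clm_comp continuous_const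
  have h_value := tendstoUniformlyOn_inv_smul_sub
    (fun s x => hasDerivAt_slice (hψ_diff (s, x))) hψ'_cont hb.isCompact_closure hs h_pos hh
  have h_fderiv := tendstoUniformlyOn_inv_smul_sub
    (G := fun p => fderiv ℝ (fun z => ψ (p.1, z)) p.2) (hasDerivAt_fderiv_slice hψ) hψ''_cont
    hb.isCompact_closure hs h_pos hh
  simp only [← fun x => (hasDerivAt_slice (hψ_diff (t, x))).deriv] at h_value
  simp only [← fderiv_deriv_slice hψ t] at h_fderiv
  refine tendsto_W1inf_sub hΩ (fun i => differentiable_of_C2 _)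
    ((contDiff_deriv_slice hψ t).differentiable one_ne_zero) (h_value.mono subset_closure)
    ((h_fderiv.mono subset_closure).congr (.of_forall fun i x _ => ?_))
  have h_diff := fun σ => differentiable_of_C2 (slice ψ hψ σ) x
  rw [Submodule.coe_smul, Submodule.coe_sub, fderiv_const_smul ((h_diff _).sub (h_diff _)),
    fderiv_sub (h_diff _) (h_diff _)]
  rfl

end W1infSlices

section Families

theorem abs_ciSup_sub_ciSup_le {ι : Type*} [Nonempty ι] {u v : ι → ℝ} {ε : ℝ}
    (hv : BddAbove (range v)) (h : ∀ j, |u j - v j| ≤ ε) : |(⨆ j, u j) - ⨆ j, v j| ≤ ε := by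
  have hu : BddAbove (range u) := by
    obtain ⟨B, hB⟩ := hv
    refine ⟨B + ε, forall_mem_range.2 fun j => ?_⟩
    linarith [hB (mem_range_self j), (abs_le.1 (h j)).2]
  rw [abs_sub_le_iff, sub_le_iff_le_add', sub_le_iff_le_add']
  constructor
  · exact ciSup_le fun j => by linarith [le_ciSup hv j, (abs_le.1 (h j)).2]
  · exact ciSup_le fun j => by linarith [le_ciSup hu j, (abs_le.1 (h j)).1]

variable {d : ℕ} {A V : Type*} [NormedAddCommGroup V] {S : Set (E d)}

theorem ContinuousFamily.continuous_apply [TopologicalSpace A] {u : A → E d → V}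
    (hu : ContinuousFamily S u) {x : E d} (hx : x ∈ S) : Continuous fun α => u α x :=
  continuous_iff_continuousAt.2 fun α => (hu α).tendsto_at hx

theorem ContinuousFamily.continuousOn_uncurry [TopologicalSpace A] {u : A → E d → V}
    (hu : ContinuousFamily S u) (hc : ∀ α, ContinuousOn (u α) S) :
    ContinuousOn (fun p : A × E d => u p.1 p.2) (univ ×ˢ S) := by
  rintro ⟨α, x⟩ ⟨-, hx⟩
  have h_fst : Tendsto Prod.fst (𝓝[univ ×ˢ S] (α, x)) (𝓝 α) :=
    continuousWithinAt_fst
  have h_snd : Tendsto Prod.snd (𝓝[univ ×ˢ S] (α, x)) (𝓝[S] x) :=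
    tendsto_nhdsWithin_iff.2
      ⟨continuousWithinAt_snd, eventually_mem_nhdsWithin.mono fun _ hp => hp.2⟩
  exact tendsto_comp_of_locally_uniform_limit_within (hc α x hx) h_snd fun v hv =>
    ⟨S, self_mem_nhdsWithin, h_fst.eventually (hu α v hv)⟩

theorem ContinuousFamily.exists_forall_dist_lt [PseudoMetricSpace A] [CompactSpace A]
    {u : A → E d → V} (hu : ContinuousFamily S u) (hc : ∀ α, ContinuousOn (u α) S)
    (hS : IsCompact S) {ε : ℝ} (hε : 0 < ε) :
    ∃ δ > 0, ∀ α, ∀ x ∈ S, ∀ z ∈ S, dist x z < δ → dist (u α x) (u α z) < ε := by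
  obtain ⟨δ, hδ, h⟩ := Metric.uniformContinuousOn_iff.1
    ((isCompact_univ.prod hS).uniformContinuousOn_of_continuous (hu.continuousOn_uncurry hc)) ε hε
  refine ⟨δ, hδ, fun α x hx z hz hxz => h (α, x) ⟨mem_univ α, hx⟩ (α, z) ⟨mem_univ α, hz⟩ ?_⟩
  rwa [Prod.dist_eq, dist_self, max_eq_right dist_nonneg]

variable {u : ℕ → A → E d → V} {v : A → E d → V}

theorem ConvergesUniformly.eventually_norm_sub_le (h : ConvergesUniformly S u v) {ε : ℝ}
    (hε : 0 < ε) : ∀ᶠ i in atTop, ∀ α, ∀ x ∈ S, ‖u i α x - v α x‖ ≤ ε := by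
  filter_upwards [Metric.tendstoUniformlyOn_iff.1 h ε hε] with i hi α x hx
  rw [← dist_eq_norm, dist_comm]
  exact (hi (α, x) ⟨mem_univ α, hx⟩).le

theorem ConvergesUniformly.eventually_norm_sub_le_of_dist_le [PseudoMetricSpace A] [CompactSpace A]
    (h : ConvergesUniformly S u v) (hv : ContinuousFamily S v) (hc : ∀ α, ContinuousOn (v α) S)
    (hS : IsCompact S) {r : ℕ → ℝ} (hr : Tendsto r atTop (𝓝 0)) {ε : ℝ} (hε : 0 < ε) :
    ∀ᶠ i in atTop, ∀ α, ∀ y ∈ S, ∀ x ∈ S, dist x y ≤ r i → ‖u i α x - v α y‖ ≤ ε := by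
  obtain ⟨δ, hδ, hvδ⟩ := hv.exists_forall_dist_lt hc hS (half_pos hε)
  filter_upwards [h.eventually_norm_sub_le (half_pos hε), hr.eventually (gt_mem_nhds hδ)]
    with i hi hri α y hy x hx hxy
  have h_lim := hvδ α x hx y hy (hxy.trans_lt hri)
  rw [dist_eq_norm] at h_lim
  linarith [hi α x hx, norm_sub_le_norm_sub_add_norm_sub (u i α x) (v α x) (v α y)]

end Families

section Nodes

variable {d : ℕ} {A : Type*} [MetricSpace A] {pb : Problem d A}

theorem Problem.mem_frontier_iff (pb : Problem d A) {x : E d} :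
    x ∈ frontier pb.Ω ↔ x ∈ pb.ΓD ∨ x ∈ pb.Γt ∪ pb.ΓR := by
  rw [← pb.boundary_eq, union_assoc, union_comm pb.ΓR, mem_union]

theorem Problem.notMem_of_mem_frontier (pb : Problem d A) {x : E d} (hx : x ∈ frontier pb.Ω) :
    x ∉ pb.Ω :=
  fun h => hx.2 (by rwa [pb.domain.isOpen.interior_eq])

theorem Problem.notMem_of_mem_dirichlet (pb : Problem d A) {x : E d} (hx : x ∈ pb.ΓD) :
    x ∉ pb.Ω :=
  pb.notMem_of_mem_frontier (pb.mem_frontier_iff.2 (Or.inl hx))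

theorem Problem.notMem_of_mem_robin (pb : Problem d A) {x : E d} (hx : x ∈ pb.Γt ∪ pb.ΓR) :
    x ∉ pb.Ω :=
  pb.notMem_of_mem_frontier (pb.mem_frontier_iff.2 (Or.inr hx))

theorem Problem.notMem_robin_of_mem_dirichlet (pb : Problem d A) {x : E d} (hx : x ∈ pb.ΓD) :
    x ∉ pb.Γt ∪ pb.ΓR :=
  not_or.2 ⟨disjoint_left.1 pb.disjoint_Dt hx, disjoint_left.1 pb.disjoint_DR hx⟩

namespace Scheme

variable (D : Scheme pb) (i : ℕ) (α : A) (w₁ w₀ : E d → ℝ) {y : E d}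

theorem row_eq_of_mem (hy : y ∈ pb.Ω) :
    D.opE i α w₁ y + D.opI i α w₀ y - D.opF i α y =
      weakForm pb (D.aE i α y) (D.bE i α) (D.cE i α) w₁ (D.φhat i y) +
        weakForm pb (D.aI i α y) (D.bI i α) (D.cI i α) w₀ (D.φhat i y) -
          ∫ x in pb.Ω, D.f i α x * D.φhat i y x := by
  have hyD : y ∉ pb.ΓD := fun h => pb.notMem_of_mem_dirichlet h hy
  have hyB : y ∉ pb.Γt ∪ pb.ΓR := fun h => pb.notMem_of_mem_robin h hy
  simp only [opE, opI, opF, opEΩ, opIΩ, opFΩ, opEB, opIB, opFB, if_pos hy, if_neg hyB, if_neg hyD,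
    add_zero]

theorem row_eq_of_mem_robin (hy : y ∈ pb.Γt ∪ pb.ΓR) :
    D.opE i α w₁ y + D.opI i α w₀ y - D.opF i α y =
      (dini (D.bBE i α y) w₁ y + D.cBE i α y * w₁ y) +
        (dini (D.bBI i α y) w₀ y + D.cBI i α y * w₀ y) - D.gB i α y := by
  simp only [opE, opI, opF, opEΩ, opIΩ, opFΩ, opEB, opIB, opFB,
    if_neg (pb.notMem_of_mem_robin hy), if_pos hy, zero_add]

theorem row_eq_of_mem_dirichlet (hy : y ∈ pb.ΓD) :
    D.opE i α w₁ y + D.opI i α w₀ y - D.opF i α y = w₀ y - pb.g y := by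
  simp only [opE, opI, opF, opEΩ, opIΩ, opFΩ, opEB, opIB, opFB,
    if_neg (pb.notMem_of_mem_dirichlet hy), if_neg (pb.notMem_robin_of_mem_dirichlet hy),
    if_pos hy, zero_add]

theorem interior_space : interior (D.mesh i).space = pb.Ω := by
  rw [(D.isMesh i).space_eq, pb.domain.interior_closure]

theorem vertices_subset_closure : (D.mesh i).vertices ⊆ closure pb.Ω := by
  rw [← (D.isMesh i).space_eq]
  exact Geometry.SimplicialComplex.vertices_subset_space

end Scheme

end Nodes

section NormalisedHat

namespace Scheme

variable {d : ℕ} {A : Type*} [MetricSpace A] {pb : Problem d A} {D : Scheme pb} {i : ℕ} {y : E d}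

theorem φhat_nonneg (hy : y ∈ (D.mesh i).vertices) (x : E d) : 0 ≤ D.φhat i y x :=
  div_nonneg ((D.isMesh i).hat_nonneg (D.isHat i) hy x) (integral_nonneg fun _ => abs_nonneg _)

theorem dist_le_of_φhat_ne_zero (hy : y ∈ (D.mesh i).vertices) {x : E d}
    (hx : D.φhat i y x ≠ 0) : dist x y ≤ meshSize (D.mesh i) := by
  obtain ⟨k, hk, hyk, hxk⟩ := (D.isMesh i).exists_element_of_hat_ne_zero (D.isHat i) hy
    (div_ne_zero_iff.1 hx).1
  exact (D.isMesh i).dist_le_meshSize hk hxk hyk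

theorem hat_eq_zero_of_notMem (hy : y ∈ (D.mesh i).vertices) (hyΩ : y ∈ pb.Ω) {x : E d}
    (hx : x ∉ pb.Ω) : D.φ i y x = 0 := by
  rw [← D.interior_space i] at hyΩ hx
  exact of_not_not fun h =>
    hx ((D.isMesh i).mem_interior_of_hat_ne_zero (D.isHat i) hy hyΩ h)

theorem φhat_eq_zero_of_notMem (hy : y ∈ (D.mesh i).vertices) (hyΩ : y ∈ pb.Ω) {x : E d}
    (hx : x ∉ pb.Ω) : D.φhat i y x = 0 := by
  rw [φhat, hat_eq_zero_of_notMem hy hyΩ hx, zero_div]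

theorem exists_lipschitzWith_hat (hy : y ∈ (D.mesh i).vertices) (hyΩ : y ∈ pb.Ω) :
    ∃ C, LipschitzWith C (D.φ i y) := by
  rw [← D.interior_space i] at hyΩ
  exact (D.isMesh i).exists_lipschitzWith_hat (D.isHat i) hy hyΩ

theorem exists_lipschitzWith_φhat (hy : y ∈ (D.mesh i).vertices) (hyΩ : y ∈ pb.Ω) :
    ∃ C, LipschitzWith C (D.φhat i y) := by
  obtain ⟨C, hC⟩ := exists_lipschitzWith_hat hy hyΩ
  have h_smul : D.φhat i y = fun x => (∫ z in pb.Ω, |D.φ i y z|)⁻¹ • D.φ i y x :=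
    funext fun x => div_eq_inv_mul _ _
  rw [h_smul]
  exact ⟨_, (lipschitzWith_smul _).comp hC⟩

theorem continuous_φhat (hy : y ∈ (D.mesh i).vertices) (hyΩ : y ∈ pb.Ω) :
    Continuous (D.φhat i y) :=
  (exists_lipschitzWith_φhat hy hyΩ).choose_spec.continuous

theorem hasCompactSupport_hat (hy : y ∈ (D.mesh i).vertices) (hyΩ : y ∈ pb.Ω) :
    HasCompactSupport (D.φ i y) :=
  HasCompactSupport.of_support_subset_isCompact pb.domain.isBounded.isCompact_closure
    fun _ hx => subset_closure (of_not_not fun h => hx (hat_eq_zero_of_notMem hy hyΩ h))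

theorem hasCompactSupport_φhat (hy : y ∈ (D.mesh i).vertices) (hyΩ : y ∈ pb.Ω) :
    HasCompactSupport (D.φhat i y) :=
  (hasCompactSupport_hat hy hyΩ).comp_left (g := (· / ∫ z in pb.Ω, |D.φ i y z|)) (zero_div _)

theorem integrableOn_φhat (hy : y ∈ (D.mesh i).vertices) (hyΩ : y ∈ pb.Ω) :
    IntegrableOn (D.φhat i y) pb.Ω :=
  ((continuous_φhat hy hyΩ).integrable_of_hasCompactSupport
    (hasCompactSupport_φhat hy hyΩ)).integrableOn

theorem integral_abs_hat_pos (hy : y ∈ (D.mesh i).vertices) (hyΩ : y ∈ pb.Ω) :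
    0 < ∫ z in pb.Ω, |D.φ i y z| := by
  obtain ⟨C, hC⟩ := exists_lipschitzWith_hat hy hyΩ
  rw [setIntegral_eq_integral_of_forall_compl_eq_zero fun x hx => by
    rw [hat_eq_zero_of_notMem hy hyΩ hx, abs_zero]]
  refine hC.continuous.abs.integral_pos_of_hasCompactSupport_nonneg_nonzero
    ((hasCompactSupport_hat hy hyΩ).comp_left abs_zero) (fun _ => abs_nonneg _) (x := y) ?_
  rw [(D.isHat i y hy).2.1, abs_one]
  exact one_ne_zero

theorem integral_φhat (hy : y ∈ (D.mesh i).vertices) (hyΩ : y ∈ pb.Ω) :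
    ∫ z in pb.Ω, D.φhat i y z = 1 := by
  have h_abs : ∫ z in pb.Ω, |D.φ i y z| = ∫ z in pb.Ω, D.φ i y z :=
    integral_congr_ae (Eventually.of_forall fun z =>
      abs_of_nonneg ((D.isMesh i).hat_nonneg (D.isHat i) hy z))
  have h_pos := integral_abs_hat_pos hy hyΩ
  simp only [φhat]
  rw [integral_div, ← h_abs, div_self h_pos.ne']

theorem gradInner_φhat (hy : y ∈ (D.mesh i).vertices) (hyΩ : y ∈ pb.Ω) {w : E d → ℝ}
    (hw : ContDiff ℝ 2 w) :
    gradInner pb w (D.φhat i y) = -∫ x in pb.Ω, Laplacian.laplacian w x * D.φhat i y x := by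
  obtain ⟨C, hC⟩ := exists_lipschitzWith_φhat hy hyΩ
  have h_zero : ∀ x ∉ pb.Ω, D.φhat i y x = 0 := fun x => φhat_eq_zero_of_notMem hy hyΩ
  have h_grad : ∀ x ∉ pb.Ω, gradient (D.φhat i y) x = 0 := fun x hx => by
    have h_min : IsLocalMin (D.φhat i y) x :=
      Eventually.of_forall fun z => (h_zero x hx).trans_le (φhat_nonneg hy z)
    rw [gradient, h_min.fderiv_eq_zero, map_zero]
  rw [gradInner, setIntegral_eq_integral_of_forall_compl_eq_zero fun x hx => by
      rw [h_grad x hx, inner_zero_right],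
    setIntegral_eq_integral_of_forall_compl_eq_zero fun x hx => by rw [h_zero x hx, mul_zero]]
  exact integral_inner_gradient_gradient hw hC (hasCompactSupport_φhat hy hyΩ)

theorem abs_mul_φhat_le (hy : y ∈ (D.mesh i).vertices) {x : E d} {r B : ℝ}
    (h : dist x y ≤ meshSize (D.mesh i) → |r| ≤ B) :
    ‖r * D.φhat i y x‖ ≤ B * D.φhat i y x := by
  rw [Real.norm_eq_abs, abs_mul, abs_of_nonneg (φhat_nonneg hy x)]
  by_cases h0 : D.φhat i y x = 0
  · rw [h0, mul_zero, mul_zero]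
  · exact mul_le_mul_of_nonneg_right (h (dist_le_of_φhat_ne_zero hy h0)) (φhat_nonneg hy x)

theorem integrableOn_mul_φhat (hy : y ∈ (D.mesh i).vertices) (hyΩ : y ∈ pb.Ω) {g : E d → ℝ}
    (hg : AEStronglyMeasurable g (volume.restrict pb.Ω)) {B : ℝ}
    (h : ∀ᵐ x ∂volume.restrict pb.Ω, dist x y ≤ meshSize (D.mesh i) → |g x| ≤ B) :
    IntegrableOn (fun x => g x * D.φhat i y x) pb.Ω :=
  ((integrableOn_φhat hy hyΩ).const_mul B).mono'
    (hg.mul (integrableOn_φhat hy hyΩ).aestronglyMeasurable)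
    (h.mono fun _ hx => abs_mul_φhat_le hy hx)

theorem abs_integral_mul_φhat_sub_le (hy : y ∈ (D.mesh i).vertices) (hyΩ : y ∈ pb.Ω)
    {g : E d → ℝ} (hg : AEStronglyMeasurable g (volume.restrict pb.Ω)) {m ε : ℝ}
    (h : ∀ᵐ x ∂volume.restrict pb.Ω, dist x y ≤ meshSize (D.mesh i) → |g x - m| ≤ ε) :
    |(∫ x in pb.Ω, g x * D.φhat i y x) - m| ≤ ε := by
  have hφ := integrableOn_φhat hy hyΩ
  have h_const : ∀ r : ℝ, ∫ x in pb.Ω, r * D.φhat i y x = r := fun r => by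
    rw [integral_const_mul, integral_φhat hy hyΩ, mul_one]
  have hgφ : IntegrableOn (fun x => g x * D.φhat i y x) pb.Ω := by
    refine integrableOn_mul_φhat hy hyΩ hg (B := |m| + ε) (h.mono fun x hx hxy => ?_)
    linarith [hx hxy, abs_sub_abs_le_abs_sub (g x) m]
  calc |(∫ x in pb.Ω, g x * D.φhat i y x) - m|
      = ‖∫ x in pb.Ω, (g x - m) * D.φhat i y x‖ := by
        simp only [sub_mul]
        rw [integral_sub hgφ (hφ.const_mul m), h_const, Real.norm_eq_abs]
    _ ≤ ∫ x in pb.Ω, ε * D.φhat i y x :=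
        norm_integral_le_of_norm_le (hφ.const_mul ε) (h.mono fun _ hx => abs_mul_φhat_le hy hx)
    _ = ε := h_const ε

end Scheme

end NormalisedHat

section FirstOrder

/-- The first order part `-b ⬝ ∇w + c w` of the operators. -/
noncomputable def firstOrder {d : ℕ} (b : E d → E d) (c w : E d → ℝ) (x : E d) : ℝ :=
  -inner ℝ (b x) (gradient w x) + c x * w x

theorem abs_neg_inner_add_mul_le {V : Type*} [NormedAddCommGroup V] [InnerProductSpace ℝ V]
    {b p : V} {c s B P C S : ℝ} (hb : ‖b‖ ≤ B) (hp : ‖p‖ ≤ P) (hc : |c| ≤ C) (hs : |s| ≤ S) :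
    |-inner ℝ b p + c * s| ≤ B * P + C * S := by
  refine (abs_add_le _ _).trans (add_le_add ?_ ?_)
  · rw [abs_neg]
    exact (abs_real_inner_le_norm b p).trans
      (mul_le_mul hb hp (norm_nonneg p) ((norm_nonneg b).trans hb))
  · rw [abs_mul]
    exact mul_le_mul hc hs (abs_nonneg s) ((abs_nonneg c).trans hc)

theorem abs_split_firstOrder_sub_le {V : Type*} [NormedAddCommGroup V] [InnerProductSpace ℝ V]
    {bE bI b p₁ p₀ P : V} {cE cI c s₁ s₀ S f' f M η : ℝ}
    (hbE : ‖bE‖ ≤ M) (hbI : ‖bI‖ ≤ M) (hcE : |cE| ≤ M) (hcI : |cI| ≤ M)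
    (hp₁ : ‖p₁ - P‖ ≤ η) (hp₀ : ‖p₀ - P‖ ≤ η) (hs₁ : |s₁ - S| ≤ η) (hs₀ : |s₀ - S| ≤ η)
    (hb : ‖bE + bI - b‖ ≤ η) (hc : |cE + cI - c| ≤ η) (hf : |f' - f| ≤ η) :
    |(-inner ℝ bE p₁ + cE * s₁) + (-inner ℝ bI p₀ + cI * s₀) - f' -
      (-inner ℝ b P + c * S - f)| ≤ η * (4 * M + ‖P‖ + |S| + 1) := by
  have h_eq : (-inner ℝ bE p₁ + cE * s₁) + (-inner ℝ bI p₀ + cI * s₀) - f' -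
      (-inner ℝ b P + c * S - f) =
      (-inner ℝ bE (p₁ - P) + cE * (s₁ - S)) + (-inner ℝ bI (p₀ - P) + cI * (s₀ - S)) +
        (-inner ℝ (bE + bI - b) P + (cE + cI - c) * S) - (f' - f) := by
    simp only [inner_sub_right, inner_sub_left, inner_add_left]
    ring
  have hE := abs_le.1 (abs_neg_inner_add_mul_le hbE hp₁ hcE hs₁)
  have hI := abs_le.1 (abs_neg_inner_add_mul_le hbI hp₀ hcI hs₀)
  have h_coeff := abs_le.1 (abs_neg_inner_add_mul_le hb (le_refl ‖P‖) hc (le_refl |S|))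
  have h_data := abs_le.1 hf
  rw [h_eq, abs_le]
  constructor <;> linarith

theorem abs_split_diffusion_add_le {aE aI a G₁ G₀ q M η : ℝ} (haE : |aE| ≤ M) (haI : |aI| ≤ M)
    (hG₁ : |G₁ + q| ≤ η) (hG₀ : |G₀ + q| ≤ η) (ha : |a - (aE + aI)| ≤ η) :
    |aE * G₁ + aI * G₀ + a * q| ≤ η * (2 * M + |q|) := by
  have h_mul {u v U V : ℝ} (hu : |u| ≤ U) (hv : |v| ≤ V) : |u * v| ≤ U * V := by
    rw [abs_mul]
    exact mul_le_mul hu hv (abs_nonneg v) ((abs_nonneg u).trans hu)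
  calc |aE * G₁ + aI * G₀ + a * q|
      = |aE * (G₁ + q) + aI * (G₀ + q) + (a - (aE + aI)) * q| := by ring_nf
    _ ≤ M * η + M * η + η * |q| := (abs_add_three _ _ _).trans
        (add_le_add (add_le_add (h_mul haE hG₁) (h_mul haI hG₀)) (h_mul ha le_rfl))
    _ = η * (2 * M + |q|) := by ring

variable {d : ℕ} {A : Type*} [MetricSpace A] {pb : Problem d A} {D : Scheme pb} {i : ℕ}
  {y P : E d} {w : E d → ℝ} {S M η : ℝ}

theorem measurable_gradient (w : E d → ℝ) : Measurable (gradient w) :=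
  (LinearIsometryEquiv.continuous _).measurable.comp (measurable_fderiv ℝ w)

theorem Scheme.aestronglyMeasurable_firstOrder (D : Scheme pb) {b : E d → E d} {c : E d → ℝ}
    (hb : ContinuousOn b (closure pb.Ω)) (hc : ContinuousOn c (closure pb.Ω)) (hw : w ∈ D.V i) :
    AEStronglyMeasurable (firstOrder b c w) (volume.restrict pb.Ω) := by
  have hΩ := pb.domain.isOpen.measurableSet
  have hcw := hc.mul (D.continuousOn_closure hw)
  exact (((hb.mono subset_closure).aestronglyMeasurable hΩ).inner
    (measurable_gradient w).aestronglyMeasurable).neg.add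
      ((hcw.mono subset_closure).aestronglyMeasurable hΩ)

/-- On the patch of elements around `y`, the finite element function `w` has values `η`-close
to `S` and gradients `η`-close to `P`. -/
structure Scheme.HasJetNear (D : Scheme pb) (i : ℕ) (y : E d) (w : E d → ℝ) (P : E d) (S η : ℝ) :
    Prop where
  mem : w ∈ D.V i
  abs_sub_le : ∀ z ∈ closure pb.Ω, dist z y ≤ meshSize (D.mesh i) → |w z - S| ≤ η
  ae_norm_gradient_sub_le : ∀ᵐ z ∂volume.restrict pb.Ω,
    dist z y ≤ meshSize (D.mesh i) → ‖gradient w z - P‖ ≤ η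

namespace Scheme.HasJetNear

theorem norm_affineGradient_sub_le (h : D.HasJetNear i y w P S η) {k : Set (E d)}
    (hk : k ∈ elements (D.mesh i)) (hyk : y ∈ k) {l : E d →ᵃ[ℝ] ℝ} (hl : EqOn w l k) :
    ‖affineGradient l - P‖ ≤ η := by
  obtain ⟨z, hz, hzk⟩ := (dense_imp_of_ae_restrict pb.domain.isOpen
    h.ae_norm_gradient_sub_le).inter_open_nonempty _ isOpen_interior
      (interior_nonempty_of_mem_elements hk)
  rw [← (hasGradientAt_of_eqOn_affineMap hl hz).gradient]
  exact hzk ((D.isMesh i).interior_element_subset pb.domain.interior_closure hk hz)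
    ((D.isMesh i).dist_le_meshSize hk (interior_subset hz) hyk)

theorem integrableOn_firstOrder_mul_φhat (h : D.HasJetNear i y w P S η)
    (hy : y ∈ (D.mesh i).vertices) (hyΩ : y ∈ pb.Ω) {b : E d → E d} {c : E d → ℝ}
    (hb : ContinuousOn b (closure pb.Ω)) (hc : ContinuousOn c (closure pb.Ω))
    (hbM : ∀ x ∈ closure pb.Ω, ‖b x‖ ≤ M) (hcM : ∀ x ∈ closure pb.Ω, |c x| ≤ M) :
    IntegrableOn (fun x => firstOrder b c w x * D.φhat i y x) pb.Ω := by
  refine integrableOn_mul_φhat hy hyΩ (D.aestronglyMeasurable_firstOrder hb hc h.mem)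
    (B := M * (‖P‖ + η) + M * (|S| + η)) ?_
  filter_upwards [h.ae_norm_gradient_sub_le, ae_restrict_mem pb.domain.isOpen.measurableSet]
    with x h_grad hxΩ hxy
  have hx := subset_closure hxΩ
  refine abs_neg_inner_add_mul_le (hbM x hx) ?_ (hcM x hx) ?_
  · linarith [h_grad hxy, norm_sub_norm_le (gradient w x) P]
  · linarith [h.abs_sub_le x hx hxy, abs_sub_abs_le_abs_sub (w x) S]

end Scheme.HasJetNear

end FirstOrder

section Rows

variable {d : ℕ} {A : Type*} [MetricSpace A] {pb : Problem d A} {D : Scheme pb} {i : ℕ}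
  {y P : E d} {w₁ w₀ : E d → ℝ} {S q M η : ℝ} {α : A}

theorem Scheme.row_eq_add_integral (hy : y ∈ (D.mesh i).vertices) (hyΩ : y ∈ pb.Ω)
    (hM : ∀ x ∈ closure pb.Ω, ‖D.bE i α x‖ ≤ M ∧ ‖D.bI i α x‖ ≤ M ∧ |D.cE i α x| ≤ M ∧
      |D.cI i α x| ≤ M)
    (h₁ : D.HasJetNear i y w₁ P S η) (h₀ : D.HasJetNear i y w₀ P S η) :
    D.opE i α w₁ y + D.opI i α w₀ y - D.opF i α y =
      D.aE i α y * gradInner pb w₁ (D.φhat i y) + D.aI i α y * gradInner pb w₀ (D.φhat i y) +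
        ∫ x in pb.Ω, (firstOrder (D.bE i α) (D.cE i α) w₁ x +
          firstOrder (D.bI i α) (D.cI i α) w₀ x - D.f i α x) * D.φhat i y x := by
  have hE := h₁.integrableOn_firstOrder_mul_φhat hy hyΩ (D.bE_cont i α) (D.cE_cont i α)
    (fun x hx => (hM x hx).1) fun x hx => (hM x hx).2.2.1
  have hI := h₀.integrableOn_firstOrder_mul_φhat hy hyΩ (D.bI_cont i α) (D.cI_cont i α)
    (fun x hx => (hM x hx).2.1) fun x hx => (hM x hx).2.2.2
  have hF : IntegrableOn (fun x => D.f i α x * D.φhat i y x) pb.Ω :=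
    (((D.f_cont i α).mul (continuous_φhat hy hyΩ).continuousOn).integrableOn_compact
      pb.domain.isBounded.isCompact_closure).mono_set subset_closure
  have h_sum : IntegrableOn (fun x => firstOrder (D.bE i α) (D.cE i α) w₁ x * D.φhat i y x +
      firstOrder (D.bI i α) (D.cI i α) w₀ x * D.φhat i y x) pb.Ω := hE.add hI
  simp only [add_mul, sub_mul]
  rw [integral_sub h_sum hF, integral_add hE hI, D.row_eq_of_mem i α w₁ w₀ hyΩ]
  simp only [weakForm, firstOrder]
  ring

theorem Scheme.abs_row_sub_le (hy : y ∈ (D.mesh i).vertices) (hyΩ : y ∈ pb.Ω)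
    (hM : ∀ x ∈ closure pb.Ω, |D.aE i α x| ≤ M ∧ |D.aI i α x| ≤ M ∧ ‖D.bE i α x‖ ≤ M ∧
      ‖D.bI i α x‖ ≤ M ∧ |D.cE i α x| ≤ M ∧ |D.cI i α x| ≤ M)
    (h₁ : D.HasJetNear i y w₁ P S η) (h₀ : D.HasJetNear i y w₀ P S η)
    (hq₁ : |gradInner pb w₁ (D.φhat i y) + q| ≤ η) (hq₀ : |gradInner pb w₀ (D.φhat i y) + q| ≤ η)
    (ha : |pb.a α y - (D.aE i α y + D.aI i α y)| ≤ η)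
    (hbcf : ∀ x ∈ closure pb.Ω, dist x y ≤ meshSize (D.mesh i) →
      ‖D.bE i α x + D.bI i α x - pb.b α y‖ ≤ η ∧ |D.cE i α x + D.cI i α x - pb.c α y| ≤ η ∧
        |D.f i α x - pb.f α y| ≤ η) :
    |D.opE i α w₁ y + D.opI i α w₀ y - D.opF i α y - (pb.L α y q P S - pb.f α y)| ≤
      η * (6 * M + ‖P‖ + |S| + |q| + 1) := by
  have h_low := abs_integral_mul_φhat_sub_le hy hyΩ
    (((D.aestronglyMeasurable_firstOrder (D.bE_cont i α) (D.cE_cont i α) h₁.mem).add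
      (D.aestronglyMeasurable_firstOrder (D.bI_cont i α) (D.cI_cont i α) h₀.mem)).sub
        (((D.f_cont i α).mono subset_closure).aestronglyMeasurable
          pb.domain.isOpen.measurableSet))
    (m := -inner ℝ (pb.b α y) P + pb.c α y * S - pb.f α y) (ε := η * (4 * M + ‖P‖ + |S| + 1)) (by
      filter_upwards [h₁.ae_norm_gradient_sub_le, h₀.ae_norm_gradient_sub_le,
        ae_restrict_mem pb.domain.isOpen.measurableSet] with x hx₁ hx₀ hxΩ hxy
      have hx := subset_closure hxΩ
      obtain ⟨-, -, hbE, hbI, hcE, hcI⟩ := hM x hx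
      obtain ⟨hb, hc, hf⟩ := hbcf x hx hxy
      exact abs_split_firstOrder_sub_le hbE hbI hcE hcI (hx₁ hxy) (hx₀ hxy) (h₁.abs_sub_le x hx hxy)
        (h₀.abs_sub_le x hx hxy) hb hc hf)
  obtain ⟨haE, haI, -⟩ := hM y (subset_closure hyΩ)
  have h_high := abs_split_diffusion_add_le haE haI hq₁ hq₀ ha
  rw [row_eq_add_integral hy hyΩ (fun x hx => (hM x hx).2.2) h₁ h₀, Problem.L]
  rw [abs_le] at *
  simp only [Pi.add_apply, Pi.sub_apply] at h_low
  constructor <;> linarith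

theorem Scheme.abs_row_sub_le_of_mem_robin (hy : y ∈ (D.mesh i).vertices)
    (hyB : y ∈ pb.Γt ∪ pb.ΓR)
    (hM : ∀ x ∈ frontier pb.Ω, ‖D.bBE i α x‖ ≤ M ∧ ‖D.bBI i α x‖ ≤ M ∧
      |D.cBE i α x| ≤ M ∧ |D.cBI i α x| ≤ M)
    (h₁ : D.HasJetNear i y w₁ P S η) (h₀ : D.HasJetNear i y w₀ P S η)
    (hb : ‖D.bBE i α y + D.bBI i α y - pb.bB α y‖ ≤ η)
    (hc : |D.cBE i α y + D.cBI i α y - pb.cB α y| ≤ η) (hg : |D.gB i α y - pb.gB α y| ≤ η) :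
    |D.opE i α w₁ y + D.opI i α w₀ y - D.opF i α y - (pb.LB α y P S - pb.gB α y)| ≤
      η * (4 * M + ‖P‖ + |S| + 1) := by
  obtain ⟨k₁, hk₁, hyk₁, h_dini₁⟩ := (D.isMesh i).exists_element_dini_eq (D.bBE_cone i α y hy hyB)
  obtain ⟨k₀, hk₀, hyk₀, h_dini₀⟩ := (D.isMesh i).exists_element_dini_eq (D.bBI_cone i α y hy hyB)
  obtain ⟨l₁, hl₁⟩ := h₁.mem.2.1 k₁ hk₁
  obtain ⟨l₀, hl₀⟩ := h₀.mem.2.1 k₀ hk₀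
  have hy_cl := D.vertices_subset_closure i hy
  have hyy : dist y y ≤ meshSize (D.mesh i) := (D.isMesh i).dist_le_meshSize hk₁ hyk₁ hyk₁
  obtain ⟨hbE, hbI, hcE, hcI⟩ := hM y (pb.mem_frontier_iff.2 (Or.inr hyB))
  rw [D.row_eq_of_mem_robin i α w₁ w₀ hyB, h_dini₁ w₁ l₁ hl₁, h_dini₀ w₀ l₀ hl₀,
    real_inner_comm, real_inner_comm (D.bBI i α y)]
  exact abs_split_firstOrder_sub_le hbE hbI hcE hcI (h₁.norm_affineGradient_sub_le hk₁ hyk₁ hl₁)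
    (h₀.norm_affineGradient_sub_le hk₀ hyk₀ hl₀) (h₁.abs_sub_le y hy_cl hyy)
    (h₀.abs_sub_le y hy_cl hyy) hb hc hg

theorem EllipticProjection.abs_gradInner_φhat_add_le (Q : EllipticProjection D)
    (hy : y ∈ (D.mesh i).vertices) (hyΩ : y ∈ pb.Ω) (w : C2 d)
    (hΔ : ∀ x, dist x y ≤ meshSize (D.mesh i) → |Laplacian.laplacian (w : E d → ℝ) x - q| ≤ η) :
    |Scheme.gradInner pb (Q.P i w : E d → ℝ) (D.φhat i y) + q| ≤ η := by
  rw [Q.orthogonal i w y hy hyΩ, Scheme.gradInner_φhat hy hyΩ (contDiff_of_C2 w), neg_add_eq_sub,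
    abs_sub_comm]
  exact Scheme.abs_integral_mul_φhat_sub_le hy hyΩ
    (continuous_laplacian (contDiff_of_C2 w)).aestronglyMeasurable (Eventually.of_forall hΔ)

end Rows

section NodeSequences

variable {d : ℕ} {A : Type*} [MetricSpace A] {pb : Problem d A} {y : ℕ → E d} {x P : E d}
  {w w₁ w₀ : ℕ → E d → ℝ} {u : E d → ℝ} {S q ε : ℝ}

theorem Scheme.eventually_forall_dist_le_meshSize (D : Scheme pb) (hyx : Tendsto y atTop (𝓝 x))
    {p : E d → Prop} (hp : ∀ᶠ z in 𝓝 x, p z) :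
    ∀ᶠ i in atTop, ∀ z, dist z (y i) ≤ meshSize (D.mesh i) → p z := by
  obtain ⟨ρ, hρ, hp⟩ := Metric.eventually_nhds_iff.1 hp
  filter_upwards [hyx.eventually (Metric.ball_mem_nhds x (half_pos hρ)),
    D.meshSize_tendsto.eventually (gt_mem_nhds (half_pos hρ))] with i hyi hmi z hz
  exact hp (by linarith [dist_triangle z (y i) x, Metric.mem_ball.1 hyi])

theorem Scheme.eventually_hasJetNear (D : Scheme pb) (hw : ∀ i, w i ∈ D.V i) (hu : ContDiff ℝ 1 u)
    (hwu : Tendsto (fun i => W1inf pb.Ω (w i - u)) atTop (𝓝 0)) (hyx : Tendsto y atTop (𝓝 x))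
    (hε : 0 < ε) : ∀ᶠ i in atTop, D.HasJetNear i (y i) (w i) (gradient u x) (u x) ε := by
  have hε₂ := half_pos hε
  have h_grad : Continuous (gradient u) :=
    (LinearIsometryEquiv.continuous _).comp (hu.continuous_fderiv one_ne_zero)
  filter_upwards [hwu.eventually (ge_mem_nhds (ENNReal.ofReal_pos.2 hε₂)),
    D.eventually_forall_dist_le_meshSize hyx
      ((hu.continuous.tendsto x).eventually (Metric.closedBall_mem_nhds _ hε₂)),
    D.eventually_forall_dist_le_meshSize hyx
      ((h_grad.tendsto x).eventually (Metric.closedBall_mem_nhds _ hε₂))] with i hi h_val h_der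
  refine ⟨hw i, fun z hz hzy => ?_, ?_⟩
  · have h_near := h_val z hzy
    rw [Real.dist_eq] at h_near
    linarith [D.abs_sub_le_of_W1inf_le (hw i) hu.continuous hε₂.le hi hz,
      abs_sub_le (w i z) (u z) (u x)]
  · filter_upwards [D.ae_norm_gradient_sub_le (hw i) (hu.differentiable one_ne_zero) hε₂.le hi]
      with z hz hzy
    have h_near := h_der z hzy
    rw [dist_eq_norm] at h_near
    linarith [norm_sub_le_norm_sub_add_norm_sub (gradient (w i) z) (gradient u z) (gradient u x)]

theorem Scheme.tendsto_apply (D : Scheme pb) (hw : ∀ i, w i ∈ D.V i) (hu : Continuous u)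
    (hwu : Tendsto (fun i => W1inf pb.Ω (w i - u)) atTop (𝓝 0)) (hy : ∀ i, y i ∈ closure pb.Ω)
    (hyx : Tendsto y atTop (𝓝 x)) : Tendsto (fun i => w i (y i)) atTop (𝓝 (u x)) := by
  have h_diff : Tendsto (fun i => w i (y i) - u (y i)) atTop (𝓝 0) := by
    refine Metric.tendsto_nhds.2 fun ε hε => ?_
    filter_upwards [hwu.eventually (ge_mem_nhds (ENNReal.ofReal_pos.2 (half_pos hε)))] with i hi
    rw [Real.dist_0_eq_abs]
    exact (D.abs_sub_le_of_W1inf_le (hw i) hu (half_pos hε).le hi (hy i)).trans_lt (half_lt_self hε)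
  simpa using h_diff.add ((hu.tendsto x).comp hyx)

theorem Scheme.eventually_abs_row_sub_le [CompactSpace A] (D : Scheme pb)
    (hy : ∀ i, y i ∈ (D.mesh i).vertices)
    (h₁ : ∀ η > 0, ∀ᶠ i in atTop, D.HasJetNear i (y i) (w₁ i) P S η)
    (h₀ : ∀ η > 0, ∀ᶠ i in atTop, D.HasJetNear i (y i) (w₀ i) P S η)
    (hq₁ : ∀ η > 0, ∀ᶠ i in atTop, y i ∈ pb.Ω →
      |gradInner pb (w₁ i) (D.φhat i (y i)) + q| ≤ η)
    (hq₀ : ∀ η > 0, ∀ᶠ i in atTop, y i ∈ pb.Ω →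
      |gradInner pb (w₀ i) (D.φhat i (y i)) + q| ≤ η) (hε : 0 < ε) :
    ∀ᶠ i in atTop, y i ∈ pb.Ω → ∀ α, |D.opE i α (w₁ i) (y i) + D.opI i α (w₀ i) (y i) -
      D.opF i α (y i) - (pb.L α (y i) q P S - pb.f α (y i))| ≤ ε := by
  obtain ⟨M, hM⟩ := D.bounded
  obtain ⟨η, hη, hηε⟩ := exists_pos_mul_lt hε (6 * M + ‖P‖ + |S| + |q| + 1)
  have h_cpt := pb.domain.isBounded.isCompact_closure
  filter_upwards [h₁ η hη, h₀ η hη, hq₁ η hη, hq₀ η hη, D.a_conv η hη,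
    D.b_conv.eventually_norm_sub_le_of_dist_le pb.b_family pb.b_cont h_cpt D.meshSize_tendsto hη,
    D.c_conv.eventually_norm_sub_le_of_dist_le pb.c_family pb.c_cont h_cpt D.meshSize_tendsto hη,
    D.f_conv.eventually_norm_sub_le_of_dist_le pb.f_family pb.f_cont h_cpt D.meshSize_tendsto hη]
    with i h₁ h₀ hq₁ hq₀ ha hb hc hf hyΩ α
  have hy_cl := subset_closure hyΩ
  have hy_supp : y i ∈ tsupport (D.φ i (y i)) :=
    subset_tsupport _ (by simp [(D.isHat i _ (hy i)).2.1])
  rw [mul_comm] at hηε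
  exact (D.abs_row_sub_le (hy i) hyΩ (hM i α).1 h₁ h₀ (hq₁ hyΩ) (hq₀ hyΩ)
    (ha α _ (hy i) (fun h => pb.notMem_of_mem_dirichlet h hyΩ) _
      hy_supp)
    fun z hz hzy => ⟨hb α _ hy_cl z hz hzy, hc α _ hy_cl z hz hzy, hf α _ hy_cl z hz hzy⟩).trans
      hηε.le

theorem Scheme.eventually_abs_row_sub_le_of_mem_robin (D : Scheme pb)
    (hy : ∀ i, y i ∈ (D.mesh i).vertices)
    (h₁ : ∀ η > 0, ∀ᶠ i in atTop, D.HasJetNear i (y i) (w₁ i) P S η)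
    (h₀ : ∀ η > 0, ∀ᶠ i in atTop, D.HasJetNear i (y i) (w₀ i) P S η) (hε : 0 < ε) :
    ∀ᶠ i in atTop, y i ∈ pb.Γt ∪ pb.ΓR → ∀ α, |D.opE i α (w₁ i) (y i) + D.opI i α (w₀ i) (y i) -
      D.opF i α (y i) - (pb.LB α (y i) P S - pb.gB α (y i))| ≤ ε := by
  obtain ⟨M, hM⟩ := D.bounded
  obtain ⟨η, hη, hηε⟩ := exists_pos_mul_lt hε (4 * M + ‖P‖ + |S| + 1)
  filter_upwards [h₁ η hη, h₀ η hη, D.bB_conv.eventually_norm_sub_le hη,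
    D.cB_conv.eventually_norm_sub_le hη, D.gB_conv.eventually_norm_sub_le hη]
    with i h₁ h₀ hb hc hg hyB α
  have hy_fr := pb.mem_frontier_iff.2 (Or.inr hyB)
  rw [mul_comm] at hηε
  exact (D.abs_row_sub_le_of_mem_robin (hy i) hyB (hM i α).2 h₁ h₀ (hb α _ hy_fr) (hc α _ hy_fr)
    (hg α _ hy_fr)).trans hηε.le

end NodeSequences

section Operators

variable {d : ℕ} {A : Type*} [MetricSpace A] {pb : Problem d A} {t q r S : ℝ} {x P : E d}

theorem Problem.bddAbove_range_L [CompactSpace A] (pb : Problem d A) (hx : x ∈ closure pb.Ω) :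
    BddAbove (range fun α => pb.L α x q P S - pb.f α x) := by
  have ha := pb.a_family.continuous_apply hx
  have hb := pb.b_family.continuous_apply hx
  have hc := pb.c_family.continuous_apply hx
  have hf := pb.f_family.continuous_apply hx
  refine (isCompact_range ?_).bddAbove
  unfold Problem.L
  fun_prop

theorem Problem.bddAbove_range_LB [CompactSpace A] (pb : Problem d A) (hx : x ∈ frontier pb.Ω) :
    BddAbove (range fun α => pb.LB α x P S - pb.gB α x) := by
  have hb := pb.bB_family.continuous_apply hx
  have hc := pb.cB_family.continuous_apply hx
  have hg := pb.gB_family.continuous_apply hx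
  refine (isCompact_range ?_).bddAbove
  unfold Problem.LB
  fun_prop

theorem Problem.F_of_mem_domain (pb : Problem d A) (ht : t ≠ pb.T) (hx : x ∈ pb.Ω) :
    pb.F (t, x, q, P, r, S) = -r + ⨆ α, (pb.L α x q P S - pb.f α x) := by
  simp only [Problem.F, if_neg ht, if_pos hx]

theorem Problem.F_of_mem_Γt (pb : Problem d A) (ht : t ≠ pb.T) (hx : x ∈ pb.Γt) :
    pb.F (t, x, q, P, r, S) = -r + ⨆ α, (pb.LB α x P S - pb.gB α x) := by
  simp only [Problem.F, if_neg ht, if_neg (pb.notMem_of_mem_robin (Or.inl hx)), if_pos hx]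

theorem Problem.F_of_mem_ΓR (pb : Problem d A) (ht : t ≠ pb.T) (hx : x ∈ pb.ΓR) :
    pb.F (t, x, q, P, r, S) = ⨆ α, (pb.LB α x P S - pb.gB α x) := by
  simp only [Problem.F, if_neg ht, if_neg (pb.notMem_of_mem_robin (Or.inr hx)),
    if_neg (disjoint_left.1 pb.disjoint_Rt hx), if_pos hx]

theorem Problem.F_of_mem_ΓD (pb : Problem d A) (ht : t ≠ pb.T) (hx : x ∈ pb.ΓD) :
    pb.F (t, x, q, P, r, S) = S - pb.g x := by
  obtain ⟨hxt, hxR⟩ := not_or.1 (pb.notMem_robin_of_mem_dirichlet hx)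
  simp only [Problem.F, if_neg ht, if_neg (pb.notMem_of_mem_dirichlet hx), if_neg hxt, if_neg hxR]

theorem abs_neg_add_sub_neg_add_lt {r r' u v ε : ℝ} (hr : |r - r'| < ε / 2) (hu : |u - v| ≤ ε / 2) :
    |-r + u - (-r' + v)| < ε := by
  rw [abs_lt] at hr ⊢
  rw [abs_le] at hu
  constructor <;> linarith

theorem Scheme.abs_discreteF_sub_F_lt [Nonempty A] [CompactSpace A] (D : Scheme pb) {i k : ℕ}
    {w : ℝ → E d → ℝ} {y : E d} {ε : ℝ} (ht : t ≠ pb.T) (hy : y ∈ closure pb.Ω)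
    (h_time : |(w (D.s i (k + 1)) y - w (D.s i k) y) / D.h i - r| < ε / 2)
    (h_val : |w (D.s i k) y - S| < ε / 2)
    (h_rowΩ : y ∈ pb.Ω → ∀ α, |D.opE i α (w (D.s i (k + 1))) y + D.opI i α (w (D.s i k)) y -
      D.opF i α y - (pb.L α y q P S - pb.f α y)| ≤ ε / 2)
    (h_rowB : y ∈ pb.Γt ∪ pb.ΓR → ∀ α, |D.opE i α (w (D.s i (k + 1))) y +
      D.opI i α (w (D.s i k)) y - D.opF i α y - (pb.LB α y P S - pb.gB α y)| ≤ ε / 2) :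
    |D.discreteF i w k y - pb.F (t, y, q, P, r, S)| < ε := by
  have hε : ε / 2 < ε := by linarith [(abs_nonneg _).trans_lt h_val]
  rw [Scheme.discreteF, Scheme.dt]
  by_cases hyΩ : y ∈ pb.Ω
  · have h_sup := abs_ciSup_sub_ciSup_le (pb.bddAbove_range_L hy) (h_rowΩ hyΩ)
    rw [pb.F_of_mem_domain ht hyΩ, if_pos (mem_union_left _ hyΩ)]
    exact abs_neg_add_sub_neg_add_lt h_time h_sup
  have hy_fr : y ∈ frontier pb.Ω := ⟨hy, by rwa [pb.domain.isOpen.interior_eq]⟩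
  rcases pb.mem_frontier_iff.1 hy_fr with hyD | hyB
  · have hy_time : y ∉ pb.Ω ∪ pb.Γt :=
      not_or.2 ⟨hyΩ, fun h => pb.notMem_robin_of_mem_dirichlet hyD (Or.inl h)⟩
    simp only [pb.F_of_mem_ΓD ht hyD, if_neg hy_time, D.row_eq_of_mem_dirichlet _ _ _ _ hyD,
      ciSup_const, neg_zero, zero_add, sub_sub_sub_cancel_right]
    exact h_val.trans hε
  have h_sup := abs_ciSup_sub_ciSup_le (pb.bddAbove_range_LB hy_fr) (h_rowB hyB)
  by_cases hyt : y ∈ pb.Γt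
  · rw [pb.F_of_mem_Γt ht hyt, if_pos (mem_union_right _ hyt)]
    exact abs_neg_add_sub_neg_add_lt h_time h_sup
  · have hy_time : y ∉ pb.Ω ∪ pb.Γt := not_or.2 ⟨hyΩ, hyt⟩
    rw [pb.F_of_mem_ΓR ht (hyB.resolve_left hyt), if_neg hy_time, neg_zero, zero_add]
    exact h_sup.trans_lt hε

end Operators

section Consistency

variable {d : ℕ} {A : Type*} [MetricSpace A] {pb : Problem d A} {D : Scheme pb}
  {ψ : ℝ × E d → ℝ} {t ε : ℝ} {x : E d} {s : ℕ → ℝ} {k : ℕ → ℕ} {y : ℕ → E d}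

theorem EllipticProjection.tendsto_W1inf_apply_sub (Q : EllipticProjection D)
    (hψ : ContDiff ℝ 2 ψ) (hs : Tendsto s atTop (𝓝 t)) :
    Tendsto (fun i => W1inf pb.Ω (Q.apply i ψ hψ (s i) - fun z => ψ (t, z))) atTop (𝓝 0) :=
  Q.tendsto_W1inf_sub ((contDiff_of_C2 (slice ψ hψ t)).of_le one_le_two)
    (tendsto_W1inf_slice_sub hψ pb.domain.isOpen.measurableSet pb.domain.isBounded hs)

theorem EllipticProjection.eventually_hasJetNear (Q : EllipticProjection D)
    (hψ : ContDiff ℝ 2 ψ) (hs : Tendsto s atTop (𝓝 t)) (hyx : Tendsto y atTop (𝓝 x))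
    (hε : 0 < ε) :
    ∀ᶠ i in atTop, D.HasJetNear i (y i) (Q.apply i ψ hψ (s i))
      (gradient (fun z => ψ (t, z)) x) (ψ (t, x)) ε :=
  D.eventually_hasJetNear (fun i => (Q.P i _).2)
    ((contDiff_of_C2 (slice ψ hψ t)).of_le one_le_two) (Q.tendsto_W1inf_apply_sub hψ hs) hyx hε

theorem EllipticProjection.eventually_abs_gradInner_add_le (Q : EllipticProjection D)
    (hψ : ContDiff ℝ 2 ψ) (hy : ∀ i, y i ∈ (D.mesh i).vertices) (hs : Tendsto s atTop (𝓝 t))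
    (hyx : Tendsto y atTop (𝓝 x)) (hε : 0 < ε) :
    ∀ᶠ i in atTop, y i ∈ pb.Ω → |Scheme.gradInner pb (Q.apply i ψ hψ (s i)) (D.φhat i (y i)) +
      Laplacian.laplacian (fun z => ψ (t, z)) x| ≤ ε := by
  have h_lap := ((continuous_laplacian_slice hψ).tendsto (t, x)).eventually
    (Metric.closedBall_mem_nhds _ hε)
  rw [nhds_prod_eq] at h_lap
  obtain ⟨p, hp, p', hp', h_near⟩ := eventually_prod_iff.1 h_lap
  filter_upwards [hs.eventually hp, D.eventually_forall_dist_le_meshSize hyx hp']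
    with i hi hi' hyΩ
  exact Q.abs_gradInner_φhat_add_le (hy i) hyΩ (slice ψ hψ (s i)) fun z hz => h_near hi (hi' z hz)

theorem Scheme.s_succ (D : Scheme pb) (i k : ℕ) : D.s i (k + 1) = D.s i k + D.h i := by
  simp only [Scheme.s, Nat.cast_succ, add_one_mul]

theorem Scheme.tendsto_s_succ (D : Scheme pb) (hs : Tendsto (fun i => D.s i (k i)) atTop (𝓝 t)) :
    Tendsto (fun i => D.s i (k i + 1)) atTop (𝓝 t) := by
  simpa only [D.s_succ, add_zero] using hs.add D.h_tendsto

theorem EllipticProjection.tendsto_time_difference_quotient (Q : EllipticProjection D)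
    (hψ : ContDiff ℝ 2 ψ) (hy : ∀ i, y i ∈ closure pb.Ω)
    (hs : Tendsto (fun i => D.s i (k i)) atTop (𝓝 t)) (hyx : Tendsto y atTop (𝓝 x)) :
    Tendsto (fun i => (Q.apply i ψ hψ (D.s i (k i + 1)) (y i) -
      Q.apply i ψ hψ (D.s i (k i)) (y i)) / D.h i) atTop (𝓝 (deriv (fun s => ψ (s, x)) t)) := by
  have h_deriv := contDiff_deriv_slice hψ t
  refine (D.tendsto_apply (fun i => (Q.P i _).2) h_deriv.continuous
    (Q.tendsto_W1inf_sub h_deriv (tendsto_W1inf_inv_smul_slice_sub hψ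
      pb.domain.isOpen.measurableSet pb.domain.isBounded hs D.h_pos D.h_tendsto)) hy hyx).congr
        fun i => ?_
  rw [map_smul, map_sub, div_eq_inv_mul, D.s_succ]
  rfl

theorem EllipticProjection.tendsto_discreteF_sub_F [Nonempty A] [CompactSpace A]
    (Q : EllipticProjection D) (hψ : ContDiff ℝ 2 ψ) (ht : t < pb.T)
    (hy : ∀ i, y i ∈ (D.mesh i).vertices) (hs : Tendsto (fun i => D.s i (k i)) atTop (𝓝 t))
    (hyx : Tendsto y atTop (𝓝 x)) :
    Tendsto (fun i => D.discreteF i (Q.apply i ψ hψ) (k i) (y i) -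
      pb.F (t, y i, (jet ψ t x).2.2)) atTop (𝓝 0) := by
  have hs' := D.tendsto_s_succ hs
  have hy_cl := fun i => D.vertices_subset_closure i (hy i)
  refine Metric.tendsto_nhds.2 fun ε hε => ?_
  have hε₂ := half_pos hε
  filter_upwards [
    (Q.tendsto_time_difference_quotient hψ hy_cl hs hyx).eventually (Metric.ball_mem_nhds _ hε₂),
    (D.tendsto_apply (fun i => (Q.P i _).2) (contDiff_of_C2 (slice ψ hψ t)).continuous
      (Q.tendsto_W1inf_apply_sub hψ hs) hy_cl hyx).eventually (Metric.ball_mem_nhds _ hε₂),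
    D.eventually_abs_row_sub_le hy (fun η hη => Q.eventually_hasJetNear hψ hs' hyx hη)
      (fun η hη => Q.eventually_hasJetNear hψ hs hyx hη)
      (fun η hη => Q.eventually_abs_gradInner_add_le hψ hy hs' hyx hη)
      (fun η hη => Q.eventually_abs_gradInner_add_le hψ hy hs hyx hη) hε₂,
    D.eventually_abs_row_sub_le_of_mem_robin hy
      (fun η hη => Q.eventually_hasJetNear hψ hs' hyx hη)
      (fun η hη => Q.eventually_hasJetNear hψ hs hyx hη) hε₂] with i h_time h_val h_rowΩ h_rowB
  rw [Real.dist_eq] at h_time h_val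
  rw [Real.dist_0_eq_abs]
  exact D.abs_discreteF_sub_F_lt ht.ne (hy_cl i) h_time h_val h_rowΩ h_rowB

end Consistency

section Envelopes

variable {ι : Type*} {l : Filter ι} [l.NeBot] {u v : ι → ℝ}

theorem limsup_coe_le_of_tendsto_sub (h : Tendsto (fun i => u i - v i) l (𝓝 0)) :
    limsup (fun i => (u i : EReal)) l ≤ limsup (fun i => (v i : EReal)) l := by
  have h_lim : limsup (fun i => ((u i - v i : ℝ) : EReal)) l = 0 :=
    ((continuous_coe_real_ereal.tendsto 0).comp h).limsup_eq
  calc limsup (fun i => (u i : EReal)) l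
      = limsup ((fun i => ((u i - v i : ℝ) : EReal)) + fun i => (v i : EReal)) l := by
        congr 1 with i
        rw [Pi.add_apply, ← EReal.coe_add, sub_add_cancel]
    _ ≤ limsup (fun i => ((u i - v i : ℝ) : EReal)) l + limsup (fun i => (v i : EReal)) l :=
        EReal.limsup_add_le (Or.inl (h_lim ▸ EReal.zero_ne_bot))
          (Or.inl (h_lim ▸ EReal.zero_ne_top))
    _ = limsup (fun i => (v i : EReal)) l := by rw [h_lim, zero_add]

theorem liminf_coe_le_of_tendsto_sub (h : Tendsto (fun i => u i - v i) l (𝓝 0)) :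
    liminf (fun i => (v i : EReal)) l ≤ liminf (fun i => (u i : EReal)) l := by
  have h_lim : liminf (fun i => ((u i - v i : ℝ) : EReal)) l = 0 :=
    ((continuous_coe_real_ereal.tendsto 0).comp h).liminf_eq
  calc liminf (fun i => (v i : EReal)) l
      = liminf (fun i => ((u i - v i : ℝ) : EReal)) l + liminf (fun i => (v i : EReal)) l := by
        rw [h_lim, zero_add]
    _ ≤ liminf ((fun i => ((u i - v i : ℝ) : EReal)) + fun i => (v i : EReal)) l :=
        EReal.le_liminf_add
    _ = liminf (fun i => (u i : EReal)) l := by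
        congr 1 with i
        rw [Pi.add_apply, ← EReal.coe_add, sub_add_cancel]

variable {d : ℕ} {A : Type*} [MetricSpace A] (pb : Problem d A)
  {z : ι → ℝ × E d × ℝ × E d × ℝ × ℝ} {z₀ : ℝ × E d × ℝ × E d × ℝ × ℝ}

theorem Problem.limsup_le_upperF (hz : Tendsto z l (𝓝[pb.argSet] z₀))
    (h : Tendsto (fun i => u i - pb.F (z i)) l (𝓝 0)) :
    limsup (fun i => (u i : EReal)) l ≤ pb.upperF z₀ :=
  (limsup_coe_le_of_tendsto_sub h).trans
    (limsup_le_limsup_of_le (u := fun z' => (pb.F z' : EReal)) hz)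

theorem Problem.lowerF_le_liminf (hz : Tendsto z l (𝓝[pb.argSet] z₀))
    (h : Tendsto (fun i => u i - pb.F (z i)) l (𝓝 0)) :
    pb.lowerF z₀ ≤ liminf (fun i => (u i : EReal)) l :=
  (liminf_le_liminf_of_le (u := fun z' => (pb.F z' : EReal)) hz).trans
    (liminf_coe_le_of_tendsto_sub h)

end Envelopes

end HJB

theorem theorem6p1_general {d : ℕ} {A : Type*} [MetricSpace A] [CompactSpace A] [Nonempty A]
    (pb : HJB.Problem d A) (D : HJB.Scheme pb) (Q : HJB.EllipticProjection D)
    (ψ : ℝ × HJB.E d → ℝ) (hψ : ContDiff ℝ 2 ψ)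
    (t : ℝ) (ht : t ∈ Ico 0 pb.T) (x : HJB.E d) (k : ℕ → ℕ)
    (y : ℕ → HJB.E d) (hy : ∀ i, y i ∈ (D.mesh i).vertices)
    (hkt : Tendsto (fun i => D.s i (k i)) atTop (𝓝 t)) (hyx : Tendsto y atTop (𝓝 x)) :
    limsup (fun i => (D.discreteF i (Q.apply i ψ hψ) (k i) (y i) : EReal)) atTop ≤
        pb.upperF (HJB.jet ψ t x) ∧
      pb.lowerF (HJB.jet ψ t x) ≤
        liminf (fun i => (D.discreteF i (Q.apply i ψ hψ) (k i) (y i) : EReal)) atTop := by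
  have h_arg : Tendsto (fun i => (t, y i, (HJB.jet ψ t x).2.2)) atTop
      (𝓝[pb.argSet] (HJB.jet ψ t x)) :=
    tendsto_nhdsWithin_iff.2 ⟨tendsto_const_nhds.prodMk_nhds (hyx.prodMk_nhds tendsto_const_nhds),
      .of_forall fun i => ⟨Ico_subset_Icc_self ht, D.vertices_subset_closure i (hy i)⟩⟩
  have h_diff := Q.tendsto_discreteF_sub_F hψ ht.2 hy hkt hyx
  exact ⟨pb.limsup_le_upperF h_arg h_diff, pb.lowerF_le_liminf h_arg h_diff⟩

theorem theorem6p1 {d : ℕ} (hd : 2 ≤ d) {A : Type*} [MetricSpace A] [CompactSpace A] [Nonempty A]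
    (pb : HJB.Problem d A) (D : HJB.Scheme pb) (Q : HJB.EllipticProjection D)
    (ψ : ℝ × HJB.E d → ℝ) (hψ : ContDiff ℝ 2 ψ)
    (t : ℝ) (ht : t ∈ Set.Ico 0 pb.T) (x : HJB.E d) (hx : x ∈ closure pb.Ω)
    (k : ℕ → ℕ) (hk : ∀ i, k i ≤ D.steps i)
    (y : ℕ → HJB.E d) (hy : ∀ i, y i ∈ (D.mesh i).vertices)
    (hkt : Filter.Tendsto (fun i => D.s i (k i)) Filter.atTop (nhds t))
    (hyx : Filter.Tendsto y Filter.atTop (nhds x)) :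
    Filter.limsup (fun i => ((D.discreteF i (Q.apply i ψ hψ) (k i) (y i) : ℝ) : EReal))
        Filter.atTop ≤ pb.upperF (HJB.jet ψ t x) ∧
      pb.lowerF (HJB.jet ψ t x) ≤
        Filter.liminf (fun i => ((D.discreteF i (Q.apply i ψ hψ) (k i) (y i) : ℝ) : EReal))
          Filter.atTop :=
  theorem6p1_general pb D Q ψ hψ t ht x k y hy hkt hyx
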